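/- **Theorem.** For a graph on $[k]=\{1,\dots,k\}$, let its $\pm1$-adjacency matrix have off-diagonal entries $1$ (adjacent) or $-1$ (not adjacent) and zero diagonal. For positive integers $c,d,e$ with $e\le\min\{c,d\}$, let $\mathcal D_{c,d,e}$ be the set of nonnegative real $c\times d$ matrices with all row sums at most $1$, all column sums at most $1$ and all entries summing to $e$, and let $\Pi_{c,d,e}$ be the set of those matrices in $\mathcal D_{c,d,e}$ whose entries all lie in $\{0,1\}$. For each $\mathfrak n=1,2,3,\dots$ let $m,n,K$ be positive integers (functions of $\mathfrak n$) with $\max\{m,n\}=\mathfrak n$ and $K\le\min\{m,n\}$, let $p_{ij}\in[0,1]$ ($1\le i<j\le\mathfrak n$) and $\varrho_{ij}\in[0,1]$ ($1\le i<j\le K$) be real numbers (functions of $\mathfrak n$), and let $(G,H)$ be correlated Bernoulli random graphs with these parameters. That is, $G$ is a random graph on $[m]$ and $H$ a random graph on $[n]$; for $1\le i<j\le m$ the probability of $i\sim_G j$ is $p_{ij}$; for $1\le i<j\le n$ the probability of $i\sim_H j$ is $p_{ij}$; for $1\le i<j\le K$ the Pearson correlation coefficient of the indicators of $i\sim_G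 j$ and $i\sim_H j$ is $\varrho_{ij}$; and, apart from this dependence within each of the pairs of indicators just named, all adjacencies of $G$ and $H$ are collectively independent. The random graphs for all $\mathfrak n$ are defined on one probability space; nothing is assumed about the dependence between different values of $\mathfrak n$. Assume that there is a real number $q\in(0,\tfrac12)$, not depending on $\mathfrak n$, such that for all $\mathfrak n$ we have $p_{ij}\in[q,1-q]$ for all $1\le i<j\le\mathfrak n$ and $\varrho_{ij}>(1-2q)^2$ for all $1\le i<j\le K$. Let $\epsilon=\epsilon(\mathfrak n):=\min_{1\le i<j\le K}\bigl(\varrho_{ij}-(1-2q)^2\bigr)$ (with the convention $\epsilon:=0$ if $K=1$), and assume that $\lim_{\mathfrak n\to\infty}\epsilon^2K/\log\mathfrak n=\infty$. Let $A$ and $B$ be the $\pm1$-adjacency matrices (with zero diagonal) of $G$ and $H$. Then, with probability $1$, for all but finitely many $\mathfrak n$, $$\operatorname*{arg\,max}_{X\in\Pi_{m,n,K}}\operatorname{trace}(AXBX^T)=\operatorname*{arg\,max}_{X\in\mathcal D_{m,n,K}}\operatorname{trace}(AXBX^T)=\left\{\begin{bmatrix}I_K&0\\0&0\end{bmatrix}\right\},$$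 where $I_K$ is the $K\times K$ identity matrix and the zero blocks have the appropriate sizes. -/

import Mathlib

open MeasureTheory ProbabilityTheory

namespace SubgraphMatching

noncomputable section

/-! Vertices `1, …, k` are represented by `Fin k`, that is, by the numbers `0, …, k - 1`. -/

/-- The `±1`-adjacency matrix of a graph, with zero diagonal. -/
def signMatrix {k : ℕ} (G : SimpleGraph (Fin k)) : Matrix (Fin k) (Fin k) ℝ :=
  open Classical in
  Matrix.of fun i j => if i = j then 0 else if G.Adj i j then 1 else -1

/-- The `c × d` matrices with nonnegative real entries, row sums at most `1`, column sums at most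
`1`, and all entries summing to `e`. -/
def relaxedPolytope (c d e : ℕ) : Set (Matrix (Fin c) (Fin d) ℝ) :=
  {X | (∀ i j, 0 ≤ X i j) ∧ (∀ i, ∑ j, X i j ≤ 1) ∧ (∀ j, ∑ i, X i j ≤ 1) ∧
    ∑ i, ∑ j, X i j = (e : ℝ)}

/-- The `c × d` matrices with entries in `{0, 1}`, at most one `1` in each row, at most one `1` in
each column, and exactly `e` entries equal to `1`. -/
def partialPerms (c d e : ℕ) : Set (Matrix (Fin c) (Fin d) ℝ) :=
  {X | (∀ i j, X i j = 0 ∨ X i j = 1) ∧ (∀ i, ∑ j, X i j ≤ 1) ∧ (∀ j, ∑ i, X i j ≤ 1) ∧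
    ∑ i, ∑ j, X i j = (e : ℝ)}

/-- The `c × d` block matrix `[[I_e, 0], [0, 0]]`. -/
def coreMatrix (c d e : ℕ) : Matrix (Fin c) (Fin d) ℝ :=
  Matrix.of fun i j => if (i : ℕ) = (j : ℕ) ∧ (i : ℕ) < e then 1 else 0

/-- The objective function `trace (A X B Xᵀ)`. -/
def objective {c d : ℕ} (A : Matrix (Fin c) (Fin c) ℝ) (B : Matrix (Fin d) (Fin d) ℝ)
    (X : Matrix (Fin c) (Fin d) ℝ) : ℝ :=
  (A * X * B * X.transpose).trace

/-- The set of all maximizers of `f` over `S`. -/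
def argmaxOn {α : Type*} (f : α → ℝ) (S : Set α) : Set α :=
  {x | x ∈ S ∧ ∀ y ∈ S, f y ≤ f x}

/-- The random variable indicating adjacency of `i` and `j` in the random graph `G`. -/
def adjInd {Ω : Type*} {k : ℕ} (G : Ω → SimpleGraph (Fin k)) (i j : Fin k) (ω : Ω) : ℝ :=
  open Classical in
  if (G ω).Adj i j then 1 else 0

/-- The Pearson correlation coefficient of two real random variables of positive variance. -/
def pearson {Ω : Type*} [MeasurableSpace Ω] (μ : Measure Ω) (X Y : Ω → ℝ) : ℝ :=
  cov[X, Y; μ] / (√(Var[X; μ]) * √(Var[Y; μ]))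

/-- The pairs of vertices `i < j` of the core. -/
abbrev CorePair (K : ℕ) : Type := {e : Fin K × Fin K // e.1 < e.2}

/-- The pairs of vertices `i < j` that do not both belong to the core. -/
abbrev OuterPair (K k : ℕ) : Type := {e : Fin k × Fin k // e.1 < e.2 ∧ K ≤ (e.2 : ℕ)}

/-- The blocks of adjacencies that are collectively independent: one block of two adjacencies (one
in `G`, one in `H`) for each core pair, and a block of one adjacency for every pair of vertices of
`G`, and for every pair of vertices of `H`, that is not a core pair. The unused coordinate in a block
of one adjacency is `0`. -/
def block {Ω : Type*} {m n K : ℕ} (hm : K ≤ m) (hn : K ≤ n)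
    (G : Ω → SimpleGraph (Fin m)) (H : Ω → SimpleGraph (Fin n)) :
    CorePair K ⊕ (OuterPair K m ⊕ OuterPair K n) → Ω → ℝ × ℝ
  | Sum.inl e => fun ω =>
      (adjInd G (Fin.castLE hm e.1.1) (Fin.castLE hm e.1.2) ω,
        adjInd H (Fin.castLE hn e.1.1) (Fin.castLE hn e.1.2) ω)
  | Sum.inr (Sum.inl e) => fun ω => (adjInd G e.1.1 e.1.2 ω, 0)
  | Sum.inr (Sum.inr e) => fun ω => (0, adjInd H e.1.1 e.1.2 ω)

/-- `(G, H)` are correlated Bernoulli random graphs with parameters `m, n, K, p, ρ`. Only the values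
`p i j` with `i < j < max m n` and `ρ i j` with `i < j < K` matter. -/
structure IsCorrelatedBernoulli {Ω : Type*} [MeasurableSpace Ω] (μ : Measure Ω) (m n K : ℕ)
    (p ρ : ℕ → ℕ → ℝ) (G : Ω → SimpleGraph (Fin m)) (H : Ω → SimpleGraph (Fin n)) : Prop where
  core_pos : 1 ≤ K
  core_le_left : K ≤ m
  core_le_right : K ≤ n
  p_mem : ∀ i j, i < j → j < max m n → p i j ∈ Set.Icc (0 : ℝ) 1
  ρ_mem : ∀ i j, i < j → j < K → ρ i j ∈ Set.Icc (0 : ℝ) 1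
  measurable_left : ∀ i j, MeasurableSet {ω | (G ω).Adj i j}
  measurable_right : ∀ i j, MeasurableSet {ω | (H ω).Adj i j}
  prob_left : ∀ i j : Fin m, i < j → μ.real {ω | (G ω).Adj i j} = p i j
  prob_right : ∀ i j : Fin n, i < j → μ.real {ω | (H ω).Adj i j} = p i j
  correlation : ∀ i j : Fin K, i < j →
    pearson μ (adjInd G (Fin.castLE core_le_left i) (Fin.castLE core_le_left j))
      (adjInd H (Fin.castLE core_le_right i) (Fin.castLE core_le_right j)) = ρ i j
  independent : iIndepFun (block core_le_left core_le_right G H) μ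

/-- The margin `ε = min_{i < j < K} (ρ i j - (1 - 2 q)²)`. The set is finite, so the infimum is a
minimum if `K ≥ 2`; if `K ≤ 1` there are no such pairs, and the value is `0`. -/
def margin (q : ℝ) (K : ℕ) (ρ : ℕ → ℕ → ℝ) : ℝ :=
  sInf {x | ∃ i j, i < j ∧ j < K ∧ x = ρ i j - (1 - 2 * q) ^ 2}

end

end SubgraphMatching

/-!
The quadratic form of the objective is decoupled into the bilinear form `trace (A X B Yᵀ)`. Padding
with slack turns the relaxation into doubly stochastic matrices, so by Birkhoff's theorem it lies in
the convex hull of the partial permutation matrices, and since a bilinear form is linear in each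
argument it suffices to show that the value at `(X, Y)` is smaller than the value at the core for
all pairs `(X, Y) ≠ (I, I)` of partial permutation matrices.

Each such pair fails with small probability. If `X` and `Y` together miss `k` of the ones of the
core, the two values differ in about `k K` terms on each side. A term of the core has mean at least
`(1 - 2q)² + ε`, and all others, with at most `k` exceptions, have mean at most `(1 - 2q)²`, as
adjacencies with different endpoints are independent and have sign means in `[-(1 - 2q), 1 - 2q]`.
Hence the mean of the gap is at least of order `k K ε`, and as every adjacency pair influences only
boundedly many terms, McDiarmid's inequality bounds the probability that the gap is nonpositive by
`exp (-Ω(k K ε²))`. There are at most `𝔫 ^ O(k)` pairs for each `k`, so `ε² K ≫ log 𝔫` makes the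
union bound summable in `𝔫`, and the Borel–Cantelli lemma concludes.
-/

namespace SubgraphMatching

open scoped NNReal

section Polytope

theorem exists_eq_sum_toMatrix_of_sum_eq_one {α β R : Type*} [Fintype α] [DecidableEq α]
    [Fintype β] [DecidableEq β] [Field R] [LinearOrder R] [IsStrictOrderedRing R] (e : α ≃ β)
    {M : Matrix α β R} (hnonneg : ∀ i j, 0 ≤ M i j) (hrow : ∀ i, ∑ j, M i j = 1)
    (hcol : ∀ j, ∑ i, M i j = 1) :
    ∃ w : α ≃ β → R, (∀ π, 0 ≤ w π) ∧ ∑ π, w π = 1 ∧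
      ∑ π, w π • (π.toPEquiv.toMatrix : Matrix α β R) = M := by
  obtain ⟨w, hw0, hw1, hw⟩ := exists_eq_sum_perm_of_mem_doublyStochastic
    (M := M.submatrix id e) (mem_doublyStochastic_iff_sum.2
      ⟨fun i j => hnonneg i (e j), fun i => (e.sum_comp _).trans (hrow i), fun j => hcol (e j)⟩)
  let t : Equiv.Perm α ≃ (α ≃ β) := (Equiv.refl α).equivCongr e
  refine ⟨w ∘ t.symm, fun π => hw0 _, (t.symm.sum_comp w).trans hw1, ?_⟩
  rw [← t.sum_comp]
  ext i j
  have hij := congr_fun₂ hw i (e.symm j)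
  rw [Matrix.sum_apply] at hij ⊢
  simp only [Function.comp_apply, Equiv.symm_apply_apply]
  simpa [t, PEquiv.toMatrix_apply, Equiv.eq_symm_apply] using hij

/-- The doubly stochastic matrix that extends a matrix `X ∈ relaxedPolytope c d e`: the slack of the
rows of `X` is spread evenly over `c - e` new columns, and the slack of its columns over `d - e` new
rows. There is no slack if `c = e`, and then there are no new columns either. -/
noncomputable def completion {c d : ℕ} (e : ℕ) (X : Matrix (Fin c) (Fin d) ℝ) :
    Matrix (Fin c ⊕ Fin (d - e)) (Fin d ⊕ Fin (c - e)) ℝ :=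
  Matrix.fromBlocks X (Matrix.of fun i _ => (1 - ∑ j, X i j) / (c - e : ℕ))
    (Matrix.of fun _ j => (1 - ∑ i, X i j) / (d - e : ℕ)) 0

lemma add_nsmul_slack_div_eq_one {c e : ℕ} (hc : e ≤ c) {r : Fin c → ℝ} (hr : ∀ i, r i ≤ 1)
    (hsum : ∑ i, r i = e) (i : Fin c) :
    r i + (c - e : ℕ) • ((1 - r i) / (c - e : ℕ)) = 1 := by
  rcases hc.eq_or_lt with rfl | hlt
  · have hslack : ∑ i, (1 - r i) = 0 := by simp [hsum]
    have := (Finset.sum_eq_zero_iff_of_nonneg fun i _ => sub_nonneg.2 (hr i)).1 hslack i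
      (Finset.mem_univ i)
    rw [Nat.sub_self, zero_smul]
    linarith
  · have : ((c - e : ℕ) : ℝ) ≠ 0 := by exact_mod_cast (Nat.sub_pos_of_lt hlt).ne'
    rw [nsmul_eq_mul, mul_div_cancel₀ _ this, add_sub_cancel]

lemma sum_slack_div_eq_one {c e : ℕ} (hlt : e < c) {r : Fin c → ℝ} (hsum : ∑ i, r i = e) :
    ∑ i, (1 - r i) / (c - e : ℕ) = 1 := by
  have : ((c - e : ℕ) : ℝ) ≠ 0 := by exact_mod_cast (Nat.sub_pos_of_lt hlt).ne'
  rw [← Finset.sum_div, Finset.sum_sub_distrib, hsum, div_eq_one_iff_eq this]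
  simp [Nat.cast_sub hlt.le]

variable {c d e : ℕ} {X : Matrix (Fin c) (Fin d) ℝ}

lemma completion_nonneg (hX : X ∈ relaxedPolytope c d e) (i j) : 0 ≤ completion e X i j := by
  obtain ⟨hnonneg, hrow, hcol, -⟩ := hX
  rcases i with i | i <;> rcases j with j | j
  · exact hnonneg i j
  · exact div_nonneg (sub_nonneg.2 (hrow i)) (Nat.cast_nonneg _)
  · exact div_nonneg (sub_nonneg.2 (hcol j)) (Nat.cast_nonneg _)
  · exact le_rfl

lemma sum_completion_row (hc : e ≤ c) (hX : X ∈ relaxedPolytope c d e) (i) :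
    ∑ j, completion e X i j = 1 := by
  obtain ⟨-, hrow, -, hsum⟩ := hX
  rcases i with i | i
  · simpa [completion] using add_nsmul_slack_div_eq_one hc hrow hsum i
  · simpa [completion] using
      sum_slack_div_eq_one (Nat.lt_of_sub_pos i.pos) (Finset.sum_comm.trans hsum)

lemma sum_completion_col (hd : e ≤ d) (hX : X ∈ relaxedPolytope c d e) (j) :
    ∑ i, completion e X i j = 1 := by
  obtain ⟨-, -, hcol, hsum⟩ := hX
  rcases j with j | j
  · simpa [completion] using
      add_nsmul_slack_div_eq_one hd hcol (Finset.sum_comm.trans hsum) j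
  · simpa [completion] using sum_slack_div_eq_one (Nat.lt_of_sub_pos j.pos) hsum

lemma mem_partialPerms_iff :
    X ∈ partialPerms c d e ↔ X ∈ relaxedPolytope c d e ∧ ∀ i j, X i j = 0 ∨ X i j = 1 :=
  ⟨fun ⟨h, hX⟩ => ⟨⟨fun i j => by rcases h i j with h | h <;> simp [h], hX⟩, h⟩,
    fun ⟨⟨_, hX⟩, h⟩ => ⟨h, hX⟩⟩

lemma partialPerms_subset_relaxedPolytope : partialPerms c d e ⊆ relaxedPolytope c d e :=
  fun _ hX => (mem_partialPerms_iff.1 hX).1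

lemma toBlocks₁₁_mem_relaxedPolytope (hc : e ≤ c)
    {M : Matrix (Fin c ⊕ Fin (d - e)) (Fin d ⊕ Fin (c - e)) ℝ} (hnonneg : ∀ i j, 0 ≤ M i j)
    (hrow : ∀ i, ∑ j, M i j = 1) (hcol : ∀ j, ∑ i, M i j = 1) (hzero : M.toBlocks₂₂ = 0) :
    M.toBlocks₁₁ ∈ relaxedPolytope c d e := by
  simp only [Fintype.sum_sum_type] at hrow hcol
  refine ⟨fun i j => hnonneg _ _, fun i => ?_, fun j => ?_, ?_⟩
  · exact (le_add_of_nonneg_right (Finset.sum_nonneg fun j _ => hnonneg _ _)).trans_eq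
      (hrow (.inl i))
  · exact (le_add_of_nonneg_right (Finset.sum_nonneg fun i _ => hnonneg _ _)).trans_eq
      (hcol (.inl j))
  · have hupper : ∑ i, ∑ j, M.toBlocks₁₁ i j + ∑ i, ∑ j, M (.inl i) (.inr j) = c := by
      simp [← Finset.sum_add_distrib, Matrix.toBlocks₁₁, hrow]
    have hright : ∑ i, ∑ j, M (.inl i) (.inr j) = (c - e : ℕ) := by
      have hzero' : ∀ i j, M (.inr i) (.inr j) = 0 := fun i j => congr_fun₂ hzero i j
      rw [Finset.sum_comm]
      simpa [hzero'] using Finset.sum_congr rfl fun j (_ : j ∈ Finset.univ) => hcol (.inr j)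
    rw [hright, Nat.cast_sub hc] at hupper
    linarith

theorem relaxedPolytope_subset_convexHull (hc : e ≤ c) (hd : e ≤ d) :
    relaxedPolytope c d e ⊆ convexHull ℝ (partialPerms c d e) := by
  intro X hX
  obtain ⟨w, hw0, hw1, hw⟩ := exists_eq_sum_toMatrix_of_sum_eq_one
    (Fintype.equivOfCardEq (by simp only [Fintype.card_sum, Fintype.card_fin]; omega))
    (completion_nonneg hX) (sum_completion_row hc hX) (sum_completion_col hd hX)
  let P (π : Fin c ⊕ Fin (d - e) ≃ Fin d ⊕ Fin (c - e)) :
      Matrix (Fin c ⊕ Fin (d - e)) (Fin d ⊕ Fin (c - e)) ℝ := π.toPEquiv.toMatrix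
  have hPapply : ∀ π i j, P π i j = if π i = j then 1 else 0 := fun π i j => by
    simp [P, PEquiv.toMatrix_apply, eq_comm]
  have hP01 : ∀ π i j, P π i j = 0 ∨ P π i j = 1 := fun π i j => by
    rw [hPapply]; split_ifs <;> simp
  have hPnonneg : ∀ π i j, 0 ≤ P π i j := fun π i j => by
    rcases hP01 π i j with h | h <;> simp [h]
  have hPzero : ∀ π, w π ≠ 0 → (P π).toBlocks₂₂ = 0 := by
    intro π hπ
    ext i j
    have hsum : ∑ π, w π * P π (.inr i) (.inr j) = 0 := by
      simpa [Matrix.sum_apply, completion, P] using congr_fun₂ hw (.inr i) (.inr j)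
    rw [Finset.sum_eq_zero_iff_of_nonneg fun π _ => mul_nonneg (hw0 π) (hPnonneg π _ _)] at hsum
    exact (mul_eq_zero.1 (hsum π (Finset.mem_univ π))).resolve_left hπ
  have hXeq : X = ∑ π with w π ≠ 0, w π • (P π).toBlocks₁₁ := by
    rw [Finset.sum_filter_of_ne fun π _ => left_ne_zero_of_smul]
    ext i j
    simpa [Matrix.sum_apply, completion, Matrix.toBlocks₁₁, P] using
      (congr_fun₂ hw (.inl i) (.inl j)).symm
  rw [hXeq]
  refine (convex_convexHull ℝ _).sum_mem (fun π _ => hw0 π)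
    ((Finset.sum_filter_ne_zero _).trans hw1) fun π hπ => subset_convexHull ℝ _ ?_
  refine mem_partialPerms_iff.2 ⟨toBlocks₁₁_mem_relaxedPolytope hc (hPnonneg π) (fun i => ?_)
    (fun j => ?_) (hPzero π (Finset.mem_filter.1 hπ).2), fun i j => hP01 π _ _⟩
  · simp [hPapply]
  · simp [hPapply, ← Equiv.eq_symm_apply]

end Polytope

section BilinearMaximum

variable {E : Type*} [AddCommGroup E] [Module ℝ E] {S : Set E}

lemma convex_insert_setOf_lt (L : E →ₗ[ℝ] ℝ) {a : ℝ} {z : E} (hz : L z ≤ a) :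
    Convex ℝ (insert z {x | L x < a}) := by
  refine convex_iff_pairwise_pos.2 fun x hx y hy hxy s t hs ht hst => .inr ?_
  have hle : ∀ x ∈ insert z {x | L x < a}, L x ≤ a := by
    rintro x (rfl | hx)
    exacts [hz, le_of_lt hx]
  calc L (s • x + t • y) = s * L x + t * L y := by simp
    _ < s * a + t * a := by
      rcases hx with rfl | hx
      · exact add_lt_add_of_le_of_lt (mul_le_mul_of_nonneg_left hz hs.le)
          (mul_lt_mul_of_pos_left (hy.resolve_left hxy.symm) ht)
      · exact add_lt_add_of_lt_of_le (mul_lt_mul_of_pos_left hx hs)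
          (mul_le_mul_of_nonneg_left (hle y hy) ht.le)
    _ = a := by rw [← add_mul, hst, one_mul]

lemma lt_of_mem_convexHull_of_ne (L : E →ₗ[ℝ] ℝ) {a : ℝ} {z : E} (hz : L z ≤ a)
    (hS : ∀ x ∈ S, x ≠ z → L x < a) {x : E} (hx : x ∈ convexHull ℝ S) (hxz : x ≠ z) : L x < a :=
  (convexHull_min (fun y hy => or_iff_not_imp_left.2 (hS y hy)) (convex_insert_setOf_lt L hz)
    hx).resolve_left hxz

lemma bilin_self_lt_of_mem_convexHull (g : E →ₗ[ℝ] E →ₗ[ℝ] ℝ) {z : E} (hz : z ∈ S)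
    (hS : ∀ x ∈ S, ∀ y ∈ S, (x, y) ≠ (z, z) → g x y < g z z) {x : E}
    (hx : x ∈ convexHull ℝ S) (hxz : x ≠ z) : g x x < g z z := by
  have hleft : ∀ y ∈ S, g y x < g z z := fun y hy =>
    lt_of_mem_convexHull_of_ne (g y)
      (by rcases eq_or_ne y z with rfl | h
          exacts [le_rfl, (hS y hy z hz (by simp [h])).le])
      (fun u hu huz => hS y hy u hu (by simp [huz])) hx hxz
  exact lt_of_mem_convexHull_of_ne (g.flip x) (hleft z hz).le (fun y hy _ => hleft y hy) hx hxz

end BilinearMaximum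

section BoundedDifferences

/-- `F` changes by at most `c i` when only the `i`-th argument changes. This is the hypothesis of
McDiarmid's inequality. -/
def HasBoundedDifferences {ι : Type*} {β : ι → Type*} (F : (∀ i, β i) → ℝ) (c : ι → ℝ≥0) : Prop :=
  ∀ i x y, (∀ j, j ≠ i → x j = y j) → |F x - F y| ≤ c i

namespace HasBoundedDifferences

lemma comp_piCongrLeft {ι κ : Type*} {β : ι → Type*} {F : (∀ i, β i) → ℝ} {c : ι → ℝ≥0}
    (hF : HasBoundedDifferences F c) (e : κ ≃ ι) :
    HasBoundedDifferences (F ∘ e.piCongrLeft β) (c ∘ e) := by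
  intro k x y hxy
  refine hF (e k) _ _ fun i hi => ?_
  obtain ⟨j, rfl⟩ := e.surjective i
  simpa only [Equiv.piCongrLeft_apply_apply] using hxy j fun h => hi (h ▸ rfl)

lemma comp_insertNth {n : ℕ} {β : Fin (n + 1) → Type*} {F : (∀ i, β i) → ℝ}
    {c : Fin (n + 1) → ℝ≥0} (hF : HasBoundedDifferences F c) (k : Fin (n + 1)) (b : β k) :
    HasBoundedDifferences (fun y => F (Fin.insertNth k b y)) (fun j => c (k.succAbove j)) := by
  intro i x y hxy
  refine hF _ _ _ ((Fin.forall_iff_succAbove k).2 ⟨fun _ => ?_, fun j hj => ?_⟩)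
  · simp only [Fin.insertNth_apply_same]
  · simpa using hxy j fun h => hj (h ▸ rfl)

lemma abs_sub_le_sum {ι : Type*} [Fintype ι] {β : ι → Type*} {F : (∀ i, β i) → ℝ} {c : ι → ℝ≥0}
    (hF : HasBoundedDifferences F c) (x y : ∀ i, β i) : |F x - F y| ≤ ∑ i, (c i : ℝ) := by
  classical
  have hybrid : ∀ s : Finset ι, |F (s.piecewise y x) - F x| ≤ ∑ i ∈ s, (c i : ℝ) := by
    intro s
    induction s using Finset.induction_on with
    | empty => simp
    | insert i s hi ih =>
      rw [Finset.sum_insert hi, Finset.piecewise_insert]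
      exact (abs_sub_le _ (F (s.piecewise y x)) _).trans
        (add_le_add (hF i _ _ fun j hj => Function.update_of_ne hj _ _) ih)
  simpa [abs_sub_comm] using hybrid Finset.univ

lemma integrable {ι : Type*} [Finite ι] {β : ι → Type*} [∀ i, MeasurableSpace (β i)]
    {F : (∀ i, β i) → ℝ} {c : ι → ℝ≥0} (hF : HasBoundedDifferences F c) (hFm : Measurable F)
    (ν : Measure (∀ i, β i)) [IsFiniteMeasure ν] : Integrable F ν := by
  have := Fintype.ofFinite ι
  rcases isEmpty_or_nonempty (∀ i, β i) with h | ⟨⟨x₀⟩⟩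
  · exact .of_isEmpty
  refine .of_bound hFm.aestronglyMeasurable (|F x₀| + ∑ i, (c i : ℝ)) (.of_forall fun x => ?_)
  have := hF.abs_sub_le_sum x x₀
  have := abs_sub_abs_le_abs_sub (F x) (F x₀)
  rw [Real.norm_eq_abs]
  linarith

end HasBoundedDifferences

lemma hasSubgaussianMGF_of_abs_sub_le {α : Type*} [MeasurableSpace α] {μ : Measure α}
    [IsProbabilityMeasure μ] {X : α → ℝ} {c : ℝ≥0} (hX : AEMeasurable X μ)
    (hc : ∀ a b, |X a - X b| ≤ c) :
    HasSubgaussianMGF (fun a => X a - ∫ a, X a ∂μ) ((c / 2) ^ 2) μ := by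
  have : Nonempty α := nonempty_of_isProbabilityMeasure μ
  have hbdd : BddBelow (Set.range X) := by
    obtain ⟨a₀⟩ := ‹Nonempty α›
    refine ⟨X a₀ - c, ?_⟩
    rintro _ ⟨a, rfl⟩
    linarith [(abs_le.1 (hc a a₀)).1]
  have hle : ∀ b, X b ≤ (⨅ a, X a) + c := fun b => by
    have : X b - c ≤ ⨅ a, X a := le_ciInf fun a => by linarith [(abs_le.1 (hc b a)).2]
    linarith
  simpa using hasSubgaussianMGF_of_mem_Icc hX
    (.of_forall fun b => ⟨ciInf_le hbdd b, hle b⟩)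

lemma hasSubgaussianMGF_prod_add {α β : Type*} [MeasurableSpace α] [MeasurableSpace β]
    {μ : Measure α} {ν : Measure β} [SFinite μ] [SFinite ν] {X : α → ℝ} {Y : α × β → ℝ}
    {c₁ c₂ : ℝ≥0} (hX : HasSubgaussianMGF X c₁ μ) (hYm : Measurable Y)
    (hY : ∀ a, HasSubgaussianMGF (fun b => Y (a, b)) c₂ ν) :
    HasSubgaussianMGF (fun p => X p.1 + Y p) (c₁ + c₂) (μ.prod ν) := by
  have hexp : ∀ t p, Real.exp (t * (X p.1 + Y p)) = Real.exp (t * X p.1) * Real.exp (t * Y p) :=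
    fun t p => by rw [mul_add, Real.exp_add]
  have hinner : ∀ t a, ∫ b, Real.exp (t * Y (a, b)) ∂ν ≤ Real.exp (c₂ * t ^ 2 / 2) :=
    fun t a => (hY a).mgf_le t
  have hint : ∀ t, Integrable (fun p => Real.exp (t * (X p.1 + Y p))) (μ.prod ν) := by
    intro t
    simp only [hexp]
    have hm : AEStronglyMeasurable (fun p : α × β => Real.exp (t * X p.1) * Real.exp (t * Y p))
        (μ.prod ν) := by
      refine (hX.integrable_exp_mul t).aestronglyMeasurable.comp_fst.mul ?_
      exact (by fun_prop : Measurable fun p => Real.exp (t * Y p)).aestronglyMeasurable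
    refine (integrable_prod_iff hm).2
      ⟨.of_forall fun a => ((hY a).integrable_exp_mul t).const_mul (Real.exp (t * X a)), ?_⟩
    refine ((hX.integrable_exp_mul t).mul_const (Real.exp (c₂ * t ^ 2 / 2))).mono'
      hm.norm.integral_prod_right' (.of_forall fun a => ?_)
    simp only [norm_mul, Real.norm_eq_abs, Real.abs_exp, integral_const_mul]
    rw [abs_of_nonneg (integral_nonneg fun b => (Real.exp_pos _).le)]
    exact mul_le_mul_of_nonneg_left (hinner t a) (Real.exp_pos _).le
  refine ⟨hint, fun t => ?_⟩
  calc mgf (fun p => X p.1 + Y p) (μ.prod ν) t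
      = ∫ a, Real.exp (t * X a) * ∫ b, Real.exp (t * Y (a, b)) ∂ν ∂μ := by
        rw [mgf, integral_prod _ (hint t)]
        simp only [mul_add, Real.exp_add, integral_const_mul]
    _ ≤ ∫ a, Real.exp (t * X a) * Real.exp (c₂ * t ^ 2 / 2) ∂μ :=
        integral_mono_of_nonneg
          (.of_forall fun a => mul_nonneg (Real.exp_pos _).le
            (integral_nonneg fun b => (Real.exp_pos _).le))
          ((hX.integrable_exp_mul t).mul_const _)
          (.of_forall fun a => mul_le_mul_of_nonneg_left (hinner t a) (Real.exp_pos _).le)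
    _ ≤ Real.exp (c₁ * t ^ 2 / 2) * Real.exp (c₂ * t ^ 2 / 2) := by
        rw [integral_mul_const]
        exact mul_le_mul_of_nonneg_right (hX.mgf_le t) (Real.exp_pos _).le
    _ = Real.exp ((c₁ + c₂ : ℝ≥0) * t ^ 2 / 2) := by
        rw [← Real.exp_add, NNReal.coe_add]
        ring_nf

lemma hasSubgaussianMGF_prod_of_abs_sub_le {α β : Type*} [MeasurableSpace α]
    [MeasurableSpace β] {μ : Measure α} {ν : Measure β} [IsProbabilityMeasure μ] [SFinite ν]
    {F : α × β → ℝ} (hFm : Measurable F) (hFint : Integrable F (μ.prod ν)) {c₁ c₂ : ℝ≥0}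
    (hc₁ : ∀ a a', |∫ b, F (a, b) ∂ν - ∫ b, F (a', b) ∂ν| ≤ c₁)
    (hc₂ : ∀ a, HasSubgaussianMGF (fun b => F (a, b) - ∫ b, F (a, b) ∂ν) c₂ ν) :
    HasSubgaussianMGF (fun p => F p - ∫ p, F p ∂μ.prod ν) ((c₁ / 2) ^ 2 + c₂) (μ.prod ν) := by
  have hgm : Measurable fun a => ∫ b, F (a, b) ∂ν :=
    hFm.stronglyMeasurable.integral_prod_right'.measurable
  refine (hasSubgaussianMGF_prod_add
    (hasSubgaussianMGF_of_abs_sub_le (μ := μ) hgm.aemeasurable hc₁)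
    (hFm.sub (hgm.comp measurable_fst)) hc₂).congr (.of_forall fun p => ?_)
  rw [integral_prod _ hFint]
  simp

lemma hasSubgaussianMGF_pi_fin_of_hasBoundedDifferences {n : ℕ} {β : Fin n → Type*}
    [∀ i, MeasurableSpace (β i)] (ν : ∀ i, Measure (β i)) [∀ i, IsProbabilityMeasure (ν i)]
    {F : (∀ i, β i) → ℝ} {c : Fin n → ℝ≥0} (hFm : Measurable F)
    (hF : HasBoundedDifferences F c) :
    HasSubgaussianMGF (fun x => F x - ∫ x, F x ∂Measure.pi ν) (∑ i, (c i / 2) ^ 2)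
      (Measure.pi ν) := by
  induction n with
  | zero =>
    have hconst : ∀ x, F x = F isEmptyElim := fun x => congr_arg F (Subsingleton.elim _ _)
    simp only [hconst, integral_const, probReal_univ, one_smul, sub_self, Finset.univ_eq_empty,
      Finset.sum_empty]
    exact .fun_zero
  | succ n ih =>
    let e := MeasurableEquiv.piFinSuccAbove β 0
    let π := Measure.pi fun j : Fin n => ν (Fin.succAbove 0 j)
    have he : MeasurePreserving e.symm ((ν 0).prod π) (Measure.pi ν) :=
      (measurePreserving_piFinSuccAbove ν 0).symm
    have hFe : Measurable (F ∘ e.symm) := hFm.comp e.symm.measurable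
    have hFint : ∀ b, Integrable (fun y => F (e.symm (b, y))) π := fun b =>
      (hF.comp_insertNth 0 b).integrable (hFe.comp measurable_prodMk_left) π
    have hdiff : ∀ a b, |∫ y, F (e.symm (a, y)) ∂π - ∫ y, F (e.symm (b, y)) ∂π| ≤ c 0 := by
      intro a b
      rw [← integral_sub (hFint a) (hFint b), ← Real.norm_eq_abs]
      refine (norm_integral_le_of_norm_le_const (.of_forall fun y => ?_)).trans_eq
        (by rw [probReal_univ, mul_one])
      refine hF 0 _ _ ((Fin.forall_iff_succAbove 0).2 ⟨fun h => absurd rfl h, fun j _ => rfl⟩)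
    have hprod := hasSubgaussianMGF_prod_of_abs_sub_le hFe
      ((he.integrable_comp_emb e.symm.measurableEmbedding).2 (hF.integrable hFm _)) hdiff
      fun b => ih (fun j => ν (Fin.succAbove 0 j)) (hFe.comp measurable_prodMk_left)
        (hF.comp_insertNth 0 b)
    have hint : ∫ p, (F ∘ e.symm) p ∂(ν 0).prod π = ∫ x, F x ∂Measure.pi ν := he.integral_comp' F
    rw [hint, ← (measurePreserving_piFinSuccAbove ν 0).map_eq] at hprod
    rw [Fin.sum_univ_succAbove _ 0]
    refine (hprod.of_map e.measurable.aemeasurable).congr (.of_forall fun x => ?_)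
    exact congr_arg (F · - _) (e.symm_apply_apply x)

theorem hasSubgaussianMGF_of_hasBoundedDifferences {Ω ι : Type*} [MeasurableSpace Ω]
    {μ : Measure Ω} [IsProbabilityMeasure μ] [Fintype ι] {β : ι → Type*}
    [∀ i, MeasurableSpace (β i)] {ξ : ∀ i, Ω → β i} (hξ : iIndepFun ξ μ)
    (hξm : ∀ i, AEMeasurable (ξ i) μ) {F : (∀ i, β i) → ℝ} {c : ι → ℝ≥0} (hFm : Measurable F)
    (hF : HasBoundedDifferences F c) :
    HasSubgaussianMGF (fun ω => F (fun i => ξ i ω) - ∫ ω, F (fun i => ξ i ω) ∂μ)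
      (∑ i, (c i / 2) ^ 2) μ := by
  let e := (Fintype.equivFin ι).symm
  let f := MeasurableEquiv.piCongrLeft β e
  let ν i := μ.map (ξ i)
  have : ∀ i, IsProbabilityMeasure (ν i) := fun i => Measure.isProbabilityMeasure_map (hξm i)
  have hmap : μ.map (fun ω i => ξ i ω) = Measure.pi ν :=
    (iIndepFun_iff_map_fun_eq_pi_map hξm).1 hξ
  have hf : MeasurePreserving f _ (Measure.pi ν) := measurePreserving_piCongrLeft ν e
  have hξ' : AEMeasurable (fun ω i => ξ i ω) μ := aemeasurable_pi_lambda _ hξm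
  have hpi := hasSubgaussianMGF_pi_fin_of_hasBoundedDifferences (fun k => ν (e k))
    (hFm.comp f.measurable) (hF.comp_piCongrLeft e)
  have hint : ∫ x, (F ∘ f) x ∂Measure.pi (fun k => ν (e k)) = ∫ ω, F (fun i => ξ i ω) ∂μ := by
    rw [← integral_map hξ' hFm.aestronglyMeasurable, hmap]
    exact hf.integral_comp' F
  have hsum : ∑ k, ((c ∘ e) k / 2) ^ 2 = ∑ i, (c i / 2) ^ 2 := e.sum_comp fun i => (c i / 2) ^ 2
  rw [hint, hsum, ← hf.symm.map_eq, ← hmap] at hpi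
  refine ((hpi.of_map f.symm.measurable.aemeasurable).of_map hξ').congr (.of_forall fun ω => ?_)
  simp

lemma hasSubgaussianMGF_mono {Ω : Type*} [MeasurableSpace Ω] {μ : Measure Ω} {X : Ω → ℝ}
    {c c' : ℝ≥0} (hX : HasSubgaussianMGF X c μ) (hc : c ≤ c') : HasSubgaussianMGF X c' μ :=
  ⟨hX.integrable_exp_mul, fun t => (hX.mgf_le t).trans (by gcongr)⟩

lemma measureReal_nonpos_le_exp_of_hasSubgaussianMGF {Ω : Type*} [MeasurableSpace Ω]
    {μ : Measure Ω} {X : Ω → ℝ} {c : ℝ≥0}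
    (hX : HasSubgaussianMGF (fun ω => X ω - ∫ ω, X ω ∂μ) c μ) (hnonneg : 0 ≤ ∫ ω, X ω ∂μ) :
    μ.real {ω | X ω ≤ 0} ≤ Real.exp (-(∫ ω, X ω ∂μ) ^ 2 / (2 * c)) := by
  convert hX.neg.measure_ge_le hnonneg using 3 with ω
  simp

section LocalTerms

variable {ι κ : Type*} [DecidableEq ι] {T : Finset κ} {D : κ → Finset ι}

lemma sum_sq_card_filter_mem_le [Fintype ι] {d r : ℕ} (hd : ∀ τ ∈ T, (D τ).card ≤ d)
    (hr : ∀ i, (T.filter fun τ => i ∈ D τ).card ≤ r) :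
    ∑ i, (T.filter fun τ => i ∈ D τ).card ^ 2 ≤ r * (d * T.card) :=
  calc ∑ i, (T.filter fun τ => i ∈ D τ).card ^ 2
      ≤ ∑ i, r * (T.filter fun τ => i ∈ D τ).card :=
        Finset.sum_le_sum fun i _ => by rw [sq]; exact Nat.mul_le_mul_right _ (hr i)
    _ = r * ∑ τ ∈ T, (D τ).card := by
        rw [← Finset.mul_sum]
        simpa [Finset.bipartiteAbove, Finset.bipartiteBelow] using congr_arg (r * ·)
          (Finset.sum_card_bipartiteAbove_eq_sum_card_bipartiteBelow (s := Finset.univ) (t := T)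
            fun i τ => i ∈ D τ)
    _ ≤ r * (d * T.card) := by
        rw [mul_comm d]
        exact Nat.mul_le_mul_left _ (Finset.sum_le_card_nsmul _ _ _ hd)

variable {β : ι → Type*} {φ : κ → (∀ i, β i) → ℝ}

lemma hasBoundedDifferences_sum (hφ : ∀ τ ∈ T, ∀ x, |φ τ x| ≤ 1)
    (hD : ∀ τ ∈ T, DependsOn (φ τ) (D τ)) :
    HasBoundedDifferences (fun x => ∑ τ ∈ T, φ τ x)
      (fun i => 2 * (T.filter fun τ => i ∈ D τ).card) := by
  intro i x y hxy
  calc |∑ τ ∈ T, φ τ x - ∑ τ ∈ T, φ τ y| ≤ ∑ τ ∈ T, |φ τ x - φ τ y| := by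
        rw [← Finset.sum_sub_distrib]
        exact Finset.abs_sum_le_sum_abs _ _
    _ ≤ ∑ τ ∈ T, if i ∈ D τ then 2 else 0 := by
        refine Finset.sum_le_sum fun τ hτ => ?_
        split_ifs with hi
        · linarith [abs_sub (φ τ x) (φ τ y), hφ τ hτ x, hφ τ hτ y]
        · rw [hD τ hτ fun j hj => hxy j fun h => hi (h ▸ hj), sub_self, abs_zero]
    _ = (2 * (T.filter fun τ => i ∈ D τ).card : ℝ≥0) := by
        rw [← Finset.sum_filter, Finset.sum_const, nsmul_eq_mul, mul_comm]
        push_cast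
        rfl

theorem hasSubgaussianMGF_sum_of_dependsOn {Ω : Type*} [MeasurableSpace Ω] {μ : Measure Ω}
    [IsProbabilityMeasure μ] [Finite ι] [∀ i, MeasurableSpace (β i)] {ξ : ∀ i, Ω → β i}
    (hξ : iIndepFun ξ μ) (hξm : ∀ i, AEMeasurable (ξ i) μ) {d r : ℕ}
    (hφm : ∀ τ ∈ T, Measurable (φ τ)) (hφ : ∀ τ ∈ T, ∀ x, |φ τ x| ≤ 1)
    (hD : ∀ τ ∈ T, DependsOn (φ τ) (D τ)) (hd : ∀ τ ∈ T, (D τ).card ≤ d)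
    (hr : ∀ i, (T.filter fun τ => i ∈ D τ).card ≤ r) :
    HasSubgaussianMGF
      (fun ω => ∑ τ ∈ T, φ τ (fun i => ξ i ω) - ∫ ω, ∑ τ ∈ T, φ τ (fun i => ξ i ω) ∂μ)
      (r * (d * T.card)) μ := by
  have := Fintype.ofFinite ι
  refine hasSubgaussianMGF_mono (hasSubgaussianMGF_of_hasBoundedDifferences hξ hξm
    (Finset.measurable_fun_sum T hφm) (hasBoundedDifferences_sum hφ hD)) ?_
  simp only [mul_div_cancel_left₀ _ (two_ne_zero' ℝ≥0)]
  exact_mod_cast sum_sq_card_filter_mem_le hd hr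

end LocalTerms

end BoundedDifferences

section Edges

variable {k K : ℕ}

/-- The pairs of vertices `i < j` of a graph on `k` vertices, sorted into core and outer pairs as in
`block`. -/
abbrev EdgeIndex (K k : ℕ) : Type := CorePair K ⊕ OuterPair K k

/-- The two vertices of a pair, the smaller one first. -/
def edgeEnds (hK : K ≤ k) : EdgeIndex K k → Fin k × Fin k
  | Sum.inl e => (Fin.castLE hK e.1.1, Fin.castLE hK e.1.2)
  | Sum.inr e => e.1

lemma edgeEnds_lt (hK : K ≤ k) (e : EdgeIndex K k) : (edgeEnds hK e).1 < (edgeEnds hK e).2 := by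
  rcases e with e | e
  exacts [e.2, e.2.1]

lemma edgeEnds_injective (hK : K ≤ k) : Function.Injective (edgeEnds hK) := by
  rintro (⟨⟨i, j⟩, hij⟩ | ⟨⟨i, j⟩, hij⟩) (⟨⟨u, v⟩, huv⟩ | ⟨⟨u, v⟩, huv⟩) h <;>
    simp only [edgeEnds, Prod.mk.injEq, Fin.ext_iff, Fin.val_castLE, Sum.inl.injEq, Sum.inr.injEq,
      Subtype.mk.injEq, reduceCtorEq] at h hij huv ⊢ <;> omega

/-- The pairs with vertices `i` and `j`, in either order: exactly one if `i ≠ j`, and none if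
`i = j`. -/
def edgesAt (hK : K ≤ k) (i j : Fin k) : Finset (EdgeIndex K k) :=
  Finset.univ.filter fun e => s((edgeEnds hK e).1, (edgeEnds hK e).2) = s(i, j)

lemma mem_edgesAt {hK : K ≤ k} {i j : Fin k} {e : EdgeIndex K k} :
    e ∈ edgesAt hK i j ↔ s((edgeEnds hK e).1, (edgeEnds hK e).2) = s(i, j) := by
  simp [edgesAt]

lemma edgesAt_self (hK : K ≤ k) (i : Fin k) : edgesAt hK i i = ∅ := by
  refine Finset.eq_empty_of_forall_notMem fun e he => (edgeEnds_lt hK e).ne ?_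
  rcases Sym2.eq_iff.1 (mem_edgesAt.1 he) with h | h <;> exact h.1.trans h.2.symm

lemma card_edgesAt_le_one (hK : K ≤ k) (i j : Fin k) : (edgesAt hK i j).card ≤ 1 := by
  refine Finset.card_le_one.2 fun e he e' he' => edgeEnds_injective hK ?_
  rcases Sym2.eq_iff.1 ((mem_edgesAt.1 he).trans (mem_edgesAt.1 he').symm) with h | h
  · exact Prod.ext h.1 h.2
  · exact absurd (edgeEnds_lt hK e) (by rw [h.1, h.2]; exact (edgeEnds_lt hK e').not_gt)

lemma exists_mem_edgesAt (hK : K ≤ k) {i j : Fin k} (hij : i ≠ j) : ∃ e, e ∈ edgesAt hK i j := by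
  wlog h : i < j generalizing i j
  · simpa only [mem_edgesAt, Sym2.eq_swap (a := i)] using
      this hij.symm (lt_of_le_of_ne (not_lt.1 h) hij.symm)
  by_cases hj : (j : ℕ) < K
  · exact ⟨Sum.inl ⟨(⟨i, lt_trans h hj⟩, ⟨j, hj⟩), h⟩, mem_edgesAt.2 rfl⟩
  · exact ⟨Sum.inr ⟨(i, j), h, not_lt.1 hj⟩, mem_edgesAt.2 rfl⟩

lemma exists_edgesAt_eq_singleton (hK : K ≤ k) {i j : Fin k} (hij : i ≠ j) :
    ∃ e, edgesAt hK i j = {e} := by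
  obtain ⟨e, he⟩ := exists_mem_edgesAt hK hij
  exact ⟨e, Finset.eq_singleton_iff_unique_mem.2
    ⟨he, fun e' he' => Finset.card_le_one.1 (card_edgesAt_le_one hK i j) e' he' e he⟩⟩

lemma card_filter_sym2_eq_le {α κ : Type*} [DecidableEq α] {T : Finset κ} {f g : κ → α}
    (hinj : Set.InjOn (fun τ => (f τ, g τ)) (T : Set κ)) (z : Sym2 α) :
    (T.filter fun τ => z = s(f τ, g τ)).card ≤ 2 := by
  induction z using Sym2.ind with
  | _ u v =>
  refine le_trans ?_ (Finset.card_le_two (a := (u, v)) (b := (v, u)))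
  refine Finset.card_le_card_of_injOn (fun τ => (f τ, g τ)) (fun τ hτ => ?_)
    (hinj.mono (Finset.coe_subset.2 (Finset.filter_subset _ _)))
  have h := Sym2.eq_iff.1 (Finset.mem_filter.1 hτ).2
  simp only [Finset.coe_insert, Finset.coe_singleton, Set.mem_insert_iff, Set.mem_singleton_iff,
    Prod.mk.injEq]
  tauto

lemma card_filter_mem_image_edgesAt_le {κ γ : Type*} [DecidableEq γ] (hK : K ≤ k) {T : Finset κ}
    {f g : κ → Fin k} (hinj : Set.InjOn (fun τ => (f τ, g τ)) (T : Set κ))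
    {F : EdgeIndex K k → γ} (hF : Function.Injective F) (b : γ) :
    (T.filter fun τ => b ∈ (edgesAt hK (f τ) (g τ)).image F).card ≤ 2 := by
  by_cases hb : ∃ e, F e = b
  · obtain ⟨e, rfl⟩ := hb
    simpa only [hF.mem_finset_image, mem_edgesAt] using card_filter_sym2_eq_le hinj _
  · rw [Finset.filter_false_of_mem fun τ _ hτ => hb ?_, Finset.card_empty]
    · exact Nat.zero_le 2
    · obtain ⟨e, -, he⟩ := Finset.mem_image.1 hτ
      exact ⟨e, he⟩

/-- The `±1`-adjacency matrix reconstructed from the indicators of the edges; every value other than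
`1` is read as a missing edge, so that the entries are bounded for all `x`. -/
noncomputable def edgeSign (hK : K ≤ k) (x : EdgeIndex K k → ℝ) : Matrix (Fin k) (Fin k) ℝ :=
  Matrix.of fun i j => ∑ e ∈ edgesAt hK i j, if x e = 1 then 1 else -1

lemma abs_edgeSign_le_one (hK : K ≤ k) (x : EdgeIndex K k → ℝ) (i j : Fin k) :
    |edgeSign hK x i j| ≤ 1 := by
  calc |edgeSign hK x i j| ≤ ∑ e ∈ edgesAt hK i j, |if x e = 1 then (1 : ℝ) else -1| :=
        Finset.abs_sum_le_sum_abs _ _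
    _ = (edgesAt hK i j).card := by
        rw [Finset.sum_congr rfl fun e _ => show _ = (1 : ℝ) by split_ifs <;> simp]
        simp
    _ ≤ 1 := by exact_mod_cast card_edgesAt_le_one hK i j

lemma dependsOn_edgeSign (hK : K ≤ k) (i j : Fin k) :
    DependsOn (fun x => edgeSign hK x i j) (edgesAt hK i j : Set (EdgeIndex K k)) :=
  fun _ _ h => Finset.sum_congr rfl fun e he => by rw [h e he]

lemma measurable_edgeSign (hK : K ≤ k) (i j : Fin k) :
    Measurable fun x : EdgeIndex K k → ℝ => edgeSign hK x i j :=
  Finset.measurable_sum _ fun e _ => Measurable.ite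
    (measurable_pi_apply e (measurableSet_singleton 1)) measurable_const measurable_const

variable {Ω : Type*}

lemma adjInd_comm (G : Ω → SimpleGraph (Fin k)) (i j : Fin k) : adjInd G i j = adjInd G j i := by
  classical exact funext fun ω => if_congr ((G ω).adj_comm i j) rfl rfl

lemma adjInd_edgeEnds (G : Ω → SimpleGraph (Fin k)) {hK : K ≤ k} {i j : Fin k}
    {e : EdgeIndex K k} (he : e ∈ edgesAt hK i j) :
    adjInd G (edgeEnds hK e).1 (edgeEnds hK e).2 = adjInd G i j := by
  rcases Sym2.eq_iff.1 (mem_edgesAt.1 he) with ⟨h₁, h₂⟩ | ⟨h₁, h₂⟩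
  · rw [h₁, h₂]
  · rw [h₁, h₂, adjInd_comm]

lemma edgeSign_adjInd (hK : K ≤ k) (G : Ω → SimpleGraph (Fin k)) (ω : Ω) :
    edgeSign hK (fun e => adjInd G (edgeEnds hK e).1 (edgeEnds hK e).2 ω) = signMatrix (G ω) := by
  ext i j
  by_cases hij : i = j
  · simp [edgeSign, signMatrix, hij, edgesAt_self]
  · obtain ⟨e, he⟩ := exists_edgesAt_eq_singleton hK hij
    have he' : e ∈ edgesAt hK i j := he ▸ Finset.mem_singleton_self e
    simp only [edgeSign, Matrix.of_apply, he, Finset.sum_singleton, signMatrix, if_neg hij,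
      adjInd_edgeEnds G he']
    by_cases hadj : (G ω).Adj i j <;> simp [adjInd, hadj]

end Edges

section Blocks

variable {m n K : ℕ} {Ω : Type*}

/-- The index type of `block`. -/
abbrev BlockIndex (m n K : ℕ) : Type := CorePair K ⊕ (OuterPair K m ⊕ OuterPair K n)

instance : DecidableEq (BlockIndex m n K) := instDecidableEqSum

/-- The block that contains a given adjacency of the left graph. -/
def leftBlock : EdgeIndex K m → BlockIndex m n K := Sum.map id Sum.inl

/-- The block that contains a given adjacency of the right graph. -/
def rightBlock : EdgeIndex K n → BlockIndex m n K := Sum.map id Sum.inr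

lemma leftBlock_injective : Function.Injective (leftBlock : EdgeIndex K m → BlockIndex m n K) :=
  Function.Injective.sumMap Function.injective_id Sum.inl_injective

lemma rightBlock_injective : Function.Injective (rightBlock : EdgeIndex K n → BlockIndex m n K) :=
  Function.Injective.sumMap Function.injective_id Sum.inr_injective

lemma exists_eq_inl_of_leftBlock_eq_rightBlock {e : EdgeIndex K m} {f : EdgeIndex K n}
    (h : leftBlock e = rightBlock f) : ∃ a, e = Sum.inl a ∧ f = Sum.inl a := by
  rcases e with a | a <;> rcases f with b | b <;> simp_all [leftBlock, rightBlock]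

lemma fst_block_leftBlock (hm : K ≤ m) (hn : K ≤ n) (G : Ω → SimpleGraph (Fin m))
    (H : Ω → SimpleGraph (Fin n)) (e : EdgeIndex K m) (ω : Ω) :
    (block hm hn G H (leftBlock e) ω).1 = adjInd G (edgeEnds hm e).1 (edgeEnds hm e).2 ω := by
  rcases e with e | e <;> rfl

lemma snd_block_rightBlock (hm : K ≤ m) (hn : K ≤ n) (G : Ω → SimpleGraph (Fin m))
    (H : Ω → SimpleGraph (Fin n)) (e : EdgeIndex K n) (ω : Ω) :
    (block hm hn G H (rightBlock e) ω).2 = adjInd H (edgeEnds hn e).1 (edgeEnds hn e).2 ω := by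
  rcases e with e | e <;> rfl

lemma measurable_adjInd [MeasurableSpace Ω] {k : ℕ} {G : Ω → SimpleGraph (Fin k)} {i j : Fin k}
    (h : MeasurableSet {ω | (G ω).Adj i j}) : Measurable (adjInd G i j) := by
  classical
  exact Measurable.ite h measurable_const measurable_const

lemma measurable_block [MeasurableSpace Ω] (hm : K ≤ m) (hn : K ≤ n)
    {G : Ω → SimpleGraph (Fin m)} {H : Ω → SimpleGraph (Fin n)}
    (hG : ∀ i j, MeasurableSet {ω | (G ω).Adj i j})
    (hH : ∀ i j, MeasurableSet {ω | (H ω).Adj i j}) (b : BlockIndex m n K) :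
    Measurable (block hm hn G H b) := by
  rcases b with e | e | e
  · exact (measurable_adjInd (hG _ _)).prodMk (measurable_adjInd (hH _ _))
  · exact (measurable_adjInd (hG _ _)).prodMk measurable_const
  · exact measurable_const.prodMk (measurable_adjInd (hH _ _))

end Blocks

section Matchings

variable {m n K : ℕ}

/-- The set of positions of the ones of a partial permutation matrix with `K` ones. -/
structure IsMatching (K : ℕ) (P : Finset (Fin m × Fin n)) : Prop where
  card_eq : P.card = K
  injOn_fst : Set.InjOn Prod.fst (P : Set (Fin m × Fin n))
  injOn_snd : Set.InjOn Prod.snd (P : Set (Fin m × Fin n))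

/-- The positions of the ones of `coreMatrix m n K`. -/
def corePairs (m n K : ℕ) : Finset (Fin m × Fin n) :=
  Finset.univ.filter fun s => (s.1 : ℕ) = s.2 ∧ (s.1 : ℕ) < K

lemma mem_corePairs {s : Fin m × Fin n} :
    s ∈ corePairs m n K ↔ (s.1 : ℕ) = s.2 ∧ (s.1 : ℕ) < K := by
  simp [corePairs]

lemma isMatching_corePairs (hm : K ≤ m) (hn : K ≤ n) : IsMatching K (corePairs m n K) where
  card_eq := by
    have himage : corePairs m n K =
        Finset.univ.image fun i : Fin K => (Fin.castLE hm i, Fin.castLE hn i) := by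
      ext ⟨a, b⟩
      simp only [mem_corePairs, Finset.mem_image, Finset.mem_univ, true_and, Prod.mk.injEq,
        Fin.ext_iff, Fin.val_castLE]
      exact ⟨fun h => ⟨⟨a, h.2⟩, rfl, h.1⟩, fun ⟨i, h1, h2⟩ => ⟨by omega, by omega⟩⟩
    rw [himage, Finset.card_image_of_injective, Finset.card_univ, Fintype.card_fin]
    intro i j hij
    simpa [Fin.ext_iff] using hij
  injOn_fst := by
    intro s hs t ht hst
    rw [Finset.mem_coe, mem_corePairs] at hs ht
    exact Prod.ext hst (Fin.ext (by rw [← hs.1, ← ht.1, hst]))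
  injOn_snd := by
    intro s hs t ht hst
    rw [Finset.mem_coe, mem_corePairs] at hs ht
    exact Prod.ext (Fin.ext (by rw [hs.1, ht.1, hst])) hst

/-- The product of the entries of `A` and `B` that two positions contribute to the objective. -/
def overlapTerm (A : Matrix (Fin m) (Fin m) ℝ) (B : Matrix (Fin n) (Fin n) ℝ)
    (τ : (Fin m × Fin n) × (Fin m × Fin n)) : ℝ :=
  A τ.1.1 τ.2.1 * B τ.1.2 τ.2.2

/-- The value of the bilinear form of the objective at the matrices with ones at the positions in
`P` and in `Q`. -/
def overlap (A : Matrix (Fin m) (Fin m) ℝ) (B : Matrix (Fin n) (Fin n) ℝ)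
    (P Q : Finset (Fin m × Fin n)) : ℝ :=
  ∑ τ ∈ P ×ˢ Q, overlapTerm A B τ

/-- The excess of the overlap of `C` with itself over the overlap of `P` and `Q`. -/
def overlapGap (A : Matrix (Fin m) (Fin m) ℝ) (B : Matrix (Fin n) (Fin n) ℝ)
    (C P Q : Finset (Fin m × Fin n)) : ℝ :=
  overlap A B C C - overlap A B P Q

lemma abs_overlapTerm_le_one {A : Matrix (Fin m) (Fin m) ℝ} {B : Matrix (Fin n) (Fin n) ℝ}
    (hA : ∀ i j, |A i j| ≤ 1) (hB : ∀ i j, |B i j| ≤ 1)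
    (τ : (Fin m × Fin n) × (Fin m × Fin n)) : |overlapTerm A B τ| ≤ 1 := by
  rw [overlapTerm, abs_mul]
  exact mul_le_one₀ (hA _ _) (abs_nonneg _) (hB _ _)

end Matchings

section Counting

variable {α : Type*} [DecidableEq α]

lemma card_product_sdiff_add (C P Q : Finset α) :
    ((C ×ˢ C) \ (P ×ˢ Q)).card + (C \ P).card * (C \ Q).card =
      C.card * ((C \ P).card + (C \ Q).card) := by
  have hprod := Finset.card_sdiff_add_card_inter (C ×ˢ C) (P ×ˢ Q)
  rw [Finset.product_inter_product, Finset.card_product, Finset.card_product] at hprod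
  have hP := Finset.card_sdiff_add_card_inter C P
  have hQ := Finset.card_sdiff_add_card_inter C Q
  rw [← hP] at hprod ⊢
  nlinarith

lemma card_product_sdiff_le (C P Q : Finset α) :
    ((C ×ˢ C) \ (P ×ˢ Q)).card ≤ C.card * ((C \ P).card + (C \ Q).card) := by
  have := card_product_sdiff_add C P Q
  omega

lemma card_mul_le_two_mul_card_product_sdiff (C P Q : Finset α) :
    C.card * ((C \ P).card + (C \ Q).card) ≤ 2 * ((C ×ˢ C) \ (P ×ˢ Q)).card := by
  have := card_product_sdiff_add C P Q
  have hP : (C \ P).card ≤ C.card := Finset.card_le_card Finset.sdiff_subset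
  have hQ : (C \ Q).card ≤ C.card := Finset.card_le_card Finset.sdiff_subset
  nlinarith

lemma card_filter_eq_product_sdiff_le (C P Q : Finset α) :
    (((C ×ˢ C) \ (P ×ˢ Q)).filter fun τ => τ.1 = τ.2).card ≤ (C \ P).card + (C \ Q).card := by
  refine le_trans (Finset.card_le_card_of_injOn Prod.fst ?_ ?_) (Finset.card_union_le _ _)
  · rintro ⟨s, t⟩ h
    simp only [Finset.coe_filter, Finset.mem_sdiff, Finset.mem_product, Set.mem_ofPred_eq,
      not_and_or] at h
    obtain ⟨⟨hC, h⟩, rfl⟩ := h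
    simp only [Finset.coe_union, Finset.coe_sdiff, Set.mem_union, Set.mem_sdiff, Finset.mem_coe]
    exact h.imp (fun h => ⟨hC.1, h⟩) fun h => ⟨hC.1, h⟩
  · intro τ h τ' h' hfst
    exact Prod.ext hfst
      ((Finset.mem_filter.1 h).2.symm.trans (hfst.trans (Finset.mem_filter.1 h').2))

lemma sum_sub_sum_eq_sum_symmDiff (S T : Finset α) (f : α → ℝ) :
    ∑ a ∈ S, f a - ∑ a ∈ T, f a = ∑ a ∈ symmDiff S T, (if a ∈ S then 1 else -1) * f a := by
  rw [symmDiff_def, Finset.sup_eq_union, Finset.sum_union disjoint_sdiff_sdiff,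
    ← Finset.sum_sdiff_sub_sum_sdiff, sub_eq_add_neg, ← Finset.sum_neg_distrib]
  congr 1 <;> refine Finset.sum_congr rfl fun a ha => ?_
  · rw [if_pos (Finset.mem_sdiff.1 ha).1, one_mul]
  · rw [if_neg (Finset.mem_sdiff.1 ha).2, neg_one_mul]

lemma card_symmDiff_of_card_eq {S T : Finset α} (h : T.card = S.card) :
    (symmDiff S T).card = 2 * (S \ T).card := by
  rw [symmDiff_def, Finset.sup_eq_union, Finset.card_union_of_disjoint disjoint_sdiff_sdiff,
    Finset.card_sdiff_comm h, two_mul]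

end Counting

section Concentration

variable {m n K : ℕ}

/-- The blocks on which the term of two positions depends. -/
def termBlocks (hm : K ≤ m) (hn : K ≤ n) (τ : (Fin m × Fin n) × (Fin m × Fin n)) :
    Finset (BlockIndex m n K) :=
  (edgesAt hm τ.1.1 τ.2.1).image leftBlock ∪ (edgesAt hn τ.1.2 τ.2.2).image rightBlock

lemma card_termBlocks_le_two (hm : K ≤ m) (hn : K ≤ n)
    (τ : (Fin m × Fin n) × (Fin m × Fin n)) : (termBlocks hm hn τ).card ≤ 2 :=
  (Finset.card_union_le _ _).trans (Nat.add_le_add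
    (Finset.card_image_le.trans (card_edgesAt_le_one _ _ _))
    (Finset.card_image_le.trans (card_edgesAt_le_one _ _ _)))

lemma card_filter_mem_termBlocks_le_four {L L' : ℕ} (hm : K ≤ m) (hn : K ≤ n)
    {P Q : Finset (Fin m × Fin n)} (hP : IsMatching L P) (hQ : IsMatching L' Q)
    (b : BlockIndex m n K) :
    ((P ×ˢ Q).filter fun τ => b ∈ termBlocks hm hn τ).card ≤ 4 := by
  simp only [termBlocks, Finset.mem_union, Finset.filter_or]
  refine (Finset.card_union_le _ _).trans (Nat.add_le_add (b := 2) (d := 2) ?_ ?_)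
  · refine card_filter_mem_image_edgesAt_le hm ?_ leftBlock_injective b
    rw [Finset.coe_product]
    exact hP.injOn_fst.prodMap hQ.injOn_fst
  · refine card_filter_mem_image_edgesAt_le hn ?_ rightBlock_injective b
    rw [Finset.coe_product]
    exact hP.injOn_snd.prodMap hQ.injOn_snd

lemma card_filter_mem_termBlocks_symmDiff_le_eight {L : ℕ} (hm : K ≤ m) (hn : K ≤ n)
    {C P Q : Finset (Fin m × Fin n)} (hC : IsMatching L C) (hP : IsMatching L P)
    (hQ : IsMatching L Q) (b : BlockIndex m n K) :
    ((symmDiff (C ×ˢ C) (P ×ˢ Q)).filter fun τ => b ∈ termBlocks hm hn τ).card ≤ 8 := by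
  calc _ ≤ (((C ×ˢ C) ∪ (P ×ˢ Q)).filter fun τ => b ∈ termBlocks hm hn τ).card :=
        Finset.card_le_card (Finset.filter_subset_filter _ symmDiff_le_sup)
    _ ≤ 4 + 4 := by
        rw [Finset.filter_union]
        exact (Finset.card_union_le _ _).trans
          (Nat.add_le_add (card_filter_mem_termBlocks_le_four hm hn hC hC b)
            (card_filter_mem_termBlocks_le_four hm hn hP hQ b))

/-- The term of two positions as a function of the values of all blocks. -/
noncomputable def blockTerm (hm : K ≤ m) (hn : K ≤ n) (τ : (Fin m × Fin n) × (Fin m × Fin n))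
    (x : BlockIndex m n K → ℝ × ℝ) : ℝ :=
  overlapTerm (edgeSign hm fun e => (x (leftBlock e)).1)
    (edgeSign hn fun e => (x (rightBlock e)).2) τ

lemma dependsOn_blockTerm (hm : K ≤ m) (hn : K ≤ n) (τ : (Fin m × Fin n) × (Fin m × Fin n)) :
    DependsOn (blockTerm hm hn τ) (termBlocks hm hn τ : Set (BlockIndex m n K)) := by
  intro x y h
  refine congrArg₂ (· * ·) (dependsOn_edgeSign hm _ _ fun e he => ?_)
    (dependsOn_edgeSign hn _ _ fun e he => ?_)
  · rw [h _ (Finset.mem_union_left _ (Finset.mem_image_of_mem _ he))]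
  · rw [h _ (Finset.mem_union_right _ (Finset.mem_image_of_mem _ he))]

lemma measurable_blockTerm (hm : K ≤ m) (hn : K ≤ n) (τ : (Fin m × Fin n) × (Fin m × Fin n)) :
    Measurable (blockTerm hm hn τ) :=
  ((measurable_edgeSign hm _ _).comp (measurable_pi_lambda _ fun _ =>
    (measurable_pi_apply _).fst)).mul
  ((measurable_edgeSign hn _ _).comp (measurable_pi_lambda _ fun _ =>
    (measurable_pi_apply _).snd))

lemma abs_blockTerm_le_one (hm : K ≤ m) (hn : K ≤ n) (τ : (Fin m × Fin n) × (Fin m × Fin n))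
    (x : BlockIndex m n K → ℝ × ℝ) : |blockTerm hm hn τ x| ≤ 1 :=
  abs_overlapTerm_le_one (abs_edgeSign_le_one hm _) (abs_edgeSign_le_one hn _) τ

variable {Ω : Type*}

lemma blockTerm_block (hm : K ≤ m) (hn : K ≤ n) (G : Ω → SimpleGraph (Fin m))
    (H : Ω → SimpleGraph (Fin n)) (τ : (Fin m × Fin n) × (Fin m × Fin n)) (ω : Ω) :
    blockTerm hm hn τ (fun b => block hm hn G H b ω) =
      overlapTerm (signMatrix (G ω)) (signMatrix (H ω)) τ := by
  simp only [blockTerm, fst_block_leftBlock, snd_block_rightBlock, edgeSign_adjInd]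

variable [MeasurableSpace Ω] {μ : Measure Ω} {p ρ : ℕ → ℕ → ℝ} {G : Ω → SimpleGraph (Fin m)}
  {H : Ω → SimpleGraph (Fin n)}

lemma IsCorrelatedBernoulli.hasSubgaussianMGF_overlapGap [IsProbabilityMeasure μ]
    (h : IsCorrelatedBernoulli μ m n K p ρ G H) {L : ℕ} {C P Q : Finset (Fin m × Fin n)}
    (hC : IsMatching L C) (hP : IsMatching L P) (hQ : IsMatching L Q) :
    HasSubgaussianMGF (fun ω => overlapGap (signMatrix (G ω)) (signMatrix (H ω)) C P Q -
        ∫ ω, overlapGap (signMatrix (G ω)) (signMatrix (H ω)) C P Q ∂μ)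
      (32 * ((C ×ˢ C) \ (P ×ˢ Q)).card) μ := by
  have hm := h.core_le_left
  have hn := h.core_le_right
  have hsum (ω : Ω) : overlapGap (signMatrix (G ω)) (signMatrix (H ω)) C P Q =
      ∑ τ ∈ symmDiff (C ×ˢ C) (P ×ˢ Q), (if τ ∈ C ×ˢ C then 1 else -1) *
        blockTerm hm hn τ (fun b => block hm hn G H b ω) := by
    simp only [overlapGap, overlap, sum_sub_sum_eq_sum_symmDiff, blockTerm_block]
  have hcard : (symmDiff (C ×ˢ C) (P ×ˢ Q)).card = 2 * ((C ×ˢ C) \ (P ×ˢ Q)).card :=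
    card_symmDiff_of_card_eq (by
      rw [Finset.card_product, Finset.card_product, hC.card_eq, hP.card_eq, hQ.card_eq])
  have key := hasSubgaussianMGF_sum_of_dependsOn (T := symmDiff (C ×ˢ C) (P ×ˢ Q))
    (D := termBlocks hm hn)
    (φ := fun τ x => (if τ ∈ C ×ˢ C then 1 else -1) * blockTerm hm hn τ x) h.independent
    (fun b => (measurable_block hm hn h.measurable_left h.measurable_right b).aemeasurable)
    (fun τ _ => (measurable_blockTerm hm hn τ).const_mul _)
    (fun τ _ x => by
      split_ifs <;> simpa only [one_mul, neg_one_mul, abs_neg] using abs_blockTerm_le_one hm hn τ x)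
    (fun τ _ x y hxy => by simp only [dependsOn_blockTerm hm hn τ hxy])
    (fun τ _ => card_termBlocks_le_two hm hn τ)
    (card_filter_mem_termBlocks_symmDiff_le_eight hm hn hC hP hQ)
  simp only [hsum]
  convert key using 1
  rw [hcard]
  push_cast
  ring

end Concentration

section Moments

variable {Ω : Type*} {k l : ℕ} {G : Ω → SimpleGraph (Fin k)} {H : Ω → SimpleGraph (Fin l)}
  {i j : Fin k} {u v : Fin l}

lemma abs_signMatrix_le_one (G : SimpleGraph (Fin k)) (i j : Fin k) : |signMatrix G i j| ≤ 1 := by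
  simp only [signMatrix, Matrix.of_apply]
  split_ifs <;> simp

lemma signMatrix_self (G : SimpleGraph (Fin k)) (i : Fin k) : signMatrix G i i = 0 := by
  simp [signMatrix]

lemma signMatrix_comm (G : SimpleGraph (Fin k)) (i j : Fin k) :
    signMatrix G i j = signMatrix G j i := by
  simp only [signMatrix, Matrix.of_apply]
  classical exact if_congr eq_comm rfl (if_congr (G.adj_comm i j) rfl rfl)

lemma signMatrix_eq_adjInd (G : Ω → SimpleGraph (Fin k)) (hij : i ≠ j) (ω : Ω) :
    signMatrix (G ω) i j = 2 * adjInd G i j ω - 1 := by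
  simp only [signMatrix, Matrix.of_apply, hij, if_false, adjInd]
  split_ifs <;> norm_num

lemma adjInd_eq_indicator (G : Ω → SimpleGraph (Fin k)) (i j : Fin k) :
    adjInd G i j = {ω | (G ω).Adj i j}.indicator 1 := by
  ext ω
  simp only [adjInd, Set.indicator, Set.mem_ofPred_eq, Pi.one_apply]

variable [MeasurableSpace Ω] {μ : Measure Ω}

lemma measurable_signMatrix (h : MeasurableSet {ω | (G ω).Adj i j}) :
    Measurable fun ω => signMatrix (G ω) i j := by
  by_cases hij : i = j
  · simp [signMatrix, hij]
  · simp only [signMatrix_eq_adjInd G hij]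
    exact ((measurable_adjInd h).const_mul 2).sub_const 1

lemma integral_adjInd (h : MeasurableSet {ω | (G ω).Adj i j}) :
    ∫ ω, adjInd G i j ω ∂μ = μ.real {ω | (G ω).Adj i j} := by
  rw [adjInd_eq_indicator, integral_indicator_one h]

variable [IsProbabilityMeasure μ]

lemma memLp_adjInd (h : MeasurableSet {ω | (G ω).Adj i j}) : MemLp (adjInd G i j) 2 μ := by
  rw [adjInd_eq_indicator]
  exact memLp_indicator_const 2 h (1 : ℝ) (Or.inr (measure_ne_top μ _))

lemma variance_adjInd (h : MeasurableSet {ω | (G ω).Adj i j}) :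
    Var[adjInd G i j; μ] = μ.real {ω | (G ω).Adj i j} * (1 - μ.real {ω | (G ω).Adj i j}) := by
  have hsq : (adjInd G i j) ^ 2 = adjInd G i j := by
    ext ω
    simp only [Pi.pow_apply, adjInd]
    split_ifs <;> simp
  rw [variance_eq_sub (memLp_adjInd h), hsq, integral_adjInd h]
  ring

lemma integral_signMatrix_mul (hij : i ≠ j) (huv : u ≠ v)
    (hG : MeasurableSet {ω | (G ω).Adj i j}) (hH : MeasurableSet {ω | (H ω).Adj u v}) :
    ∫ ω, signMatrix (G ω) i j * signMatrix (H ω) u v ∂μ =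
      4 * cov[adjInd G i j, adjInd H u v; μ] +
        (2 * μ.real {ω | (G ω).Adj i j} - 1) * (2 * μ.real {ω | (H ω).Adj u v} - 1) := by
  have hX : MemLp (fun ω => 2 * adjInd G i j ω) 2 μ := (memLp_adjInd hG).const_mul 2
  have hY : MemLp (fun ω => 2 * adjInd H u v ω) 2 μ := (memLp_adjInd hH).const_mul 2
  have hXi := hX.integrable one_le_two
  have hYi := hY.integrable one_le_two
  have hcov := covariance_eq_sub (hX.sub (memLp_const 1)) (hY.sub (memLp_const 1))
  simp only [Pi.sub_def, Pi.mul_def, covariance_sub_const_left hXi,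
    covariance_sub_const_right hYi, covariance_const_mul_left, covariance_const_mul_right,
    integral_sub hXi (integrable_const _), integral_sub hYi (integrable_const _),
    integral_const_mul, integral_adjInd hG, integral_adjInd hH, integral_const, probReal_univ,
    smul_eq_mul, mul_one] at hcov
  simp only [signMatrix_eq_adjInd G hij, signMatrix_eq_adjInd H huv]
  linarith

end Moments

section Correlations

variable {Ω : Type*} [MeasurableSpace Ω] {μ : Measure Ω} {m n K : ℕ} {p ρ : ℕ → ℕ → ℝ}
  {G : Ω → SimpleGraph (Fin m)} {H : Ω → SimpleGraph (Fin n)} {q ε : ℝ}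

namespace IsCorrelatedBernoulli

lemma prob_mem_left (h : IsCorrelatedBernoulli μ m n K p ρ G H)
    (hp : ∀ i j, i < j → j < max m n → p i j ∈ Set.Icc q (1 - q)) {i j : Fin m} (hij : i ≠ j) :
    μ.real {ω | (G ω).Adj i j} ∈ Set.Icc q (1 - q) := by
  wlog hlt : i < j generalizing i j
  · simpa only [SimpleGraph.adj_comm] using
      this hij.symm (lt_of_le_of_ne (not_lt.1 hlt) hij.symm)
  rw [h.prob_left i j hlt]
  exact hp i j hlt (lt_max_of_lt_left j.2)

lemma prob_mem_right (h : IsCorrelatedBernoulli μ m n K p ρ G H)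
    (hp : ∀ i j, i < j → j < max m n → p i j ∈ Set.Icc q (1 - q)) {i j : Fin n} (hij : i ≠ j) :
    μ.real {ω | (H ω).Adj i j} ∈ Set.Icc q (1 - q) := by
  wlog hlt : i < j generalizing i j
  · simpa only [SimpleGraph.adj_comm] using
      this hij.symm (lt_of_le_of_ne (not_lt.1 hlt) hij.symm)
  rw [h.prob_right i j hlt]
  exact hp i j hlt (lt_max_of_lt_right j.2)

lemma indepFun_adjInd (h : IsCorrelatedBernoulli μ m n K p ρ G H) {i j : Fin m} {u v : Fin n}
    (hij : i ≠ j) (huv : u ≠ v)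
    (hne : ¬ ((i : ℕ) < K ∧ (j : ℕ) < K ∧ s((i : ℕ), (j : ℕ)) = s((u : ℕ), (v : ℕ)))) :
    IndepFun (adjInd G i j) (adjInd H u v) μ := by
  obtain ⟨e, he⟩ := exists_mem_edgesAt h.core_le_left hij
  obtain ⟨f, hf⟩ := exists_mem_edgesAt h.core_le_right huv
  have hblock : (leftBlock e : BlockIndex m n K) ≠ rightBlock f := by
    intro heq
    obtain ⟨a, rfl, rfl⟩ := exists_eq_inl_of_leftBlock_eq_rightBlock heq
    refine hne ?_
    simp only [mem_edgesAt, edgeEnds, Sym2.eq_iff, Fin.ext_iff, Fin.val_castLE] at he hf ⊢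
    omega
  have hind := (h.independent.indepFun hblock).comp measurable_fst measurable_snd
  rw [← adjInd_edgeEnds G he, ← adjInd_edgeEnds H hf]
  convert hind using 1
  · exact funext fun ω => (fst_block_leftBlock _ _ G H e ω).symm
  · exact funext fun ω => (snd_block_rightBlock _ _ G H f ω).symm

variable [IsProbabilityMeasure μ]

lemma integral_signMatrix_mul_le (h : IsCorrelatedBernoulli μ m n K p ρ G H)
    (hp : ∀ i j, i < j → j < max m n → p i j ∈ Set.Icc q (1 - q)) {i j : Fin m} {u v : Fin n}
    (hne : ¬ ((i : ℕ) < K ∧ (j : ℕ) < K ∧ s((i : ℕ), (j : ℕ)) = s((u : ℕ), (v : ℕ)))) :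
    ∫ ω, signMatrix (G ω) i j * signMatrix (H ω) u v ∂μ ≤ (1 - 2 * q) ^ 2 := by
  by_cases hij : i = j
  · simpa only [hij, signMatrix_self, zero_mul, integral_zero] using sq_nonneg _
  by_cases huv : u = v
  · simpa only [huv, signMatrix_self, mul_zero, integral_zero] using sq_nonneg _
  rw [integral_signMatrix_mul hij huv (h.measurable_left i j) (h.measurable_right u v),
    (h.indepFun_adjInd hij huv hne).covariance_eq_zero (memLp_adjInd (h.measurable_left i j))
      (memLp_adjInd (h.measurable_right u v)), mul_zero, zero_add]
  obtain ⟨hx, hx'⟩ := h.prob_mem_left hp hij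
  obtain ⟨hy, hy'⟩ := h.prob_mem_right hp huv
  rw [sq]
  refine (le_abs_self _).trans ((abs_mul _ _).trans_le ?_)
  refine mul_le_mul (abs_le.2 ⟨?_, ?_⟩) (abs_le.2 ⟨?_, ?_⟩) (abs_nonneg _) ?_ <;> linarith

lemma le_integral_signMatrix_mul_castLE (h : IsCorrelatedBernoulli μ m n K p ρ G H) (hq : 0 < q)
    (hp : ∀ i j, i < j → j < max m n → p i j ∈ Set.Icc q (1 - q)) {i j : Fin K} (hij : i < j) :
    ρ i j ≤ ∫ ω, signMatrix (G ω) (Fin.castLE h.core_le_left i) (Fin.castLE h.core_le_left j) *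
      signMatrix (H ω) (Fin.castLE h.core_le_right i) (Fin.castLE h.core_le_right j) ∂μ := by
  have hl : Fin.castLE h.core_le_left i < Fin.castLE h.core_le_left j := hij
  have hr : Fin.castLE h.core_le_right i < Fin.castLE h.core_le_right j := hij
  have hcorr := h.correlation i j hij
  have hρ := h.ρ_mem i j hij j.2
  have hpm := hp i j hij (lt_max_of_lt_left (j.2.trans_le h.core_le_left))
  rw [pearson, variance_adjInd (h.measurable_left _ _), variance_adjInd (h.measurable_right _ _),
    h.prob_left _ _ hl, h.prob_right _ _ hr] at hcorr
  rw [integral_signMatrix_mul hl.ne hr.ne (h.measurable_left _ _) (h.measurable_right _ _),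
    h.prob_left _ _ hl, h.prob_right _ _ hr]
  simp only [Fin.val_castLE] at hcorr ⊢
  have hpos : 0 < p i j * (1 - p i j) := mul_pos (by linarith [hpm.1]) (by linarith [hpm.2])
  rw [Real.mul_self_sqrt hpos.le, div_eq_iff hpos.ne'] at hcorr
  have hsq : ρ i j * (2 * p i j - 1) ^ 2 ≤ (2 * p i j - 1) ^ 2 :=
    mul_le_of_le_one_left (sq_nonneg _) hρ.2
  calc ρ i j = 4 * (ρ i j * (p i j * (1 - p i j))) + ρ i j * (2 * p i j - 1) ^ 2 := by ring
    _ ≤ _ := by rw [hcorr]; linarith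

lemma le_integral_overlapTerm (h : IsCorrelatedBernoulli μ m n K p ρ G H) (hq : 0 < q)
    (hp : ∀ i j, i < j → j < max m n → p i j ∈ Set.Icc q (1 - q))
    (hρ : ∀ i j, i < j → j < K → (1 - 2 * q) ^ 2 + ε ≤ ρ i j) {s t : Fin m × Fin n}
    (hs : s ∈ corePairs m n K) (ht : t ∈ corePairs m n K) (hst : s ≠ t) :
    (1 - 2 * q) ^ 2 + ε ≤ ∫ ω, overlapTerm (signMatrix (G ω)) (signMatrix (H ω)) (s, t) ∂μ := by
  wlog hlt : s.1 < t.1 generalizing s t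
  · simpa only [overlapTerm, signMatrix_comm _ s.1, signMatrix_comm _ s.2] using
      this ht hs hst.symm (lt_of_le_of_ne (not_lt.1 hlt) fun e => hst
        ((isMatching_corePairs h.core_le_left h.core_le_right).injOn_fst hs ht e.symm))
  rw [mem_corePairs] at hs ht
  refine (hρ _ _ hlt ht.2).trans ?_
  have hle := h.le_integral_signMatrix_mul_castLE hq hp (i := ⟨s.1, hs.2⟩) (j := ⟨t.1, ht.2⟩) hlt
  rwa [show Fin.castLE h.core_le_right ⟨s.1, hs.2⟩ = s.2 from Fin.ext hs.1,
    show Fin.castLE h.core_le_right ⟨t.1, ht.2⟩ = t.2 from Fin.ext ht.1] at hle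

lemma integrable_overlapTerm (h : IsCorrelatedBernoulli μ m n K p ρ G H)
    (τ : (Fin m × Fin n) × (Fin m × Fin n)) :
    Integrable (fun ω => overlapTerm (signMatrix (G ω)) (signMatrix (H ω)) τ) μ :=
  Integrable.of_bound ((measurable_signMatrix (h.measurable_left _ _)).mul
    (measurable_signMatrix (h.measurable_right _ _))).aestronglyMeasurable 1
    (Filter.Eventually.of_forall fun _ =>
      abs_overlapTerm_le_one (abs_signMatrix_le_one _) (abs_signMatrix_le_one _) τ)

lemma integral_overlapTerm_le_one (h : IsCorrelatedBernoulli μ m n K p ρ G H)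
    (τ : (Fin m × Fin n) × (Fin m × Fin n)) :
    ∫ ω, overlapTerm (signMatrix (G ω)) (signMatrix (H ω)) τ ∂μ ≤ 1 := by
  refine (integral_mono (h.integrable_overlapTerm τ) (integrable_const 1) fun ω => ?_).trans_eq
    (by simp)
  exact (le_abs_self _).trans
    (abs_overlapTerm_le_one (abs_signMatrix_le_one _) (abs_signMatrix_le_one _) τ)

end IsCorrelatedBernoulli

end Correlations

section MeanGap

lemma card_mul_sub_card_filter_le_sum {α : Type*} {S : Finset α} {r : α → Prop}
    [DecidablePred r] {f : α → ℝ} {a : ℝ} (h : ∀ x ∈ S, ¬r x → a ≤ f x)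
    (hr : ∀ x ∈ S, r x → a - 1 ≤ f x) : S.card * a - (S.filter r).card ≤ ∑ x ∈ S, f x := by
  calc (S.card * a - (S.filter r).card : ℝ) = ∑ x ∈ S, (a - if r x then 1 else 0) := by
        rw [Finset.sum_sub_distrib, Finset.sum_const, nsmul_eq_mul, Finset.sum_boole]
    _ ≤ ∑ x ∈ S, f x := Finset.sum_le_sum fun x hx => by
        split_ifs with hx'
        · exact hr x hx hx'
        · simpa only [sub_zero] using h x hx hx'

variable {m n K : ℕ} {P Q : Finset (Fin m × Fin n)}

/-- A pair of positions `(i, j), (j, i)` with `(i, j)` outside of the core: its term is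
`A i j * B j i`, a product of correlated factors. -/
def IsSwapped (K : ℕ) (τ : (Fin m × Fin n) × (Fin m × Fin n)) : Prop :=
  τ.1 ∉ corePairs m n K ∧ (τ.2.1 : ℕ) = τ.1.2 ∧ (τ.2.2 : ℕ) = τ.1.1

lemma isSwapped_of_edges_eq {τ : (Fin m × Fin n) × (Fin m × Fin n)}
    (hτ : τ ∉ corePairs m n K ×ˢ corePairs m n K) (h1 : (τ.1.1 : ℕ) < K) (h2 : (τ.2.1 : ℕ) < K)
    (hedge : s((τ.1.1 : ℕ), (τ.2.1 : ℕ)) = s((τ.1.2 : ℕ), (τ.2.2 : ℕ))) : IsSwapped K τ := by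
  rw [Finset.mem_product, mem_corePairs, mem_corePairs] at hτ
  rw [IsSwapped, mem_corePairs]
  rw [Sym2.eq_iff] at hedge
  omega

open Classical in
lemma card_filter_isSwapped_le (P Q : Finset (Fin m × Fin n))
    (U : Finset ((Fin m × Fin n) × (Fin m × Fin n))) :
    (((P ×ˢ Q) \ U).filter (IsSwapped K)).card ≤ (P \ corePairs m n K).card := by
  refine Finset.card_le_card_of_injOn Prod.fst (fun τ h => ?_) fun τ h τ' h' hfst => ?_
  · simp only [Finset.coe_filter, Finset.mem_sdiff, Finset.mem_product, Set.mem_ofPred_eq] at h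
    exact Finset.mem_coe.2 (Finset.mem_sdiff.2 ⟨h.1.1.1, h.2.1⟩)
  · obtain ⟨-, h1, h2⟩ := (Finset.mem_filter.1 h).2
    obtain ⟨-, h1', h2'⟩ := (Finset.mem_filter.1 h').2
    exact Prod.ext hfst (Prod.ext (Fin.ext (by rw [h1, h1', hfst]))
      (Fin.ext (by rw [h2, h2', hfst])))

lemma le_sum_corePairs_sub_sum {E : (Fin m × Fin n) × (Fin m × Fin n) → ℝ} {c ε : ℝ}
    (hm : K ≤ m) (hn : K ≤ n) (hP : IsMatching K P) (hQ : IsMatching K Q)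
    (hle : ∀ τ, E τ ≤ 1) (hdiag : ∀ s ∈ corePairs m n K, 0 ≤ E (s, s))
    (hcore : ∀ s ∈ corePairs m n K, ∀ t ∈ corePairs m n K, s ≠ t → c + ε ≤ E (s, t))
    (hoff : ∀ τ ∉ corePairs m n K ×ˢ corePairs m n K, ¬IsSwapped K τ → E τ ≤ c)
    (hc : 0 ≤ c) (hcε : c + ε ≤ 1) (hε : 8 ≤ K * ε) :
    ((corePairs m n K \ P).card + (corePairs m n K \ Q).card : ℕ) * (K * ε) / 4 ≤
      ∑ τ ∈ corePairs m n K ×ˢ corePairs m n K, E τ - ∑ τ ∈ P ×ˢ Q, E τ := by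
  classical
  have hC := isMatching_corePairs hm hn
  set C := corePairs m n K
  have hε0 : 0 ≤ ε := (pos_of_mul_pos_right (by linarith) (Nat.cast_nonneg K)).le
  rw [← Finset.sum_sdiff_sub_sum_sdiff]
  have hlower := card_mul_sub_card_filter_le_sum (S := (C ×ˢ C) \ (P ×ˢ Q)) (f := E) (a := c + ε)
    (r := fun τ => τ.1 = τ.2)
    (fun τ hτ hne => hcore _ (Finset.mem_product.1 (Finset.mem_sdiff.1 hτ).1).1 _
      (Finset.mem_product.1 (Finset.mem_sdiff.1 hτ).1).2 hne)
    (by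
      rintro ⟨s, _⟩ hτ (rfl : s = _)
      linarith [hdiag s (Finset.mem_product.1 (Finset.mem_sdiff.1 hτ).1).1])
  have hupper := card_mul_sub_card_filter_le_sum (S := (P ×ˢ Q) \ (C ×ˢ C)) (f := fun τ => -E τ)
    (a := -c) (r := IsSwapped K)
    (fun τ hτ hne => neg_le_neg (hoff τ (Finset.mem_sdiff.1 hτ).2 hne))
    (fun τ _ _ => by linarith [hle τ])
  have hcard : ((P ×ˢ Q) \ (C ×ˢ C)).card = ((C ×ˢ C) \ (P ×ˢ Q)).card :=
    Finset.card_sdiff_comm (by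
      rw [Finset.card_product, Finset.card_product, hP.card_eq, hQ.card_eq, hC.card_eq])
  have hfix := card_filter_eq_product_sdiff_le C P Q
  have hswap := card_filter_isSwapped_le (K := K) P Q (C ×ˢ C)
  rw [Finset.card_sdiff_comm (hP.card_eq.trans hC.card_eq.symm)] at hswap
  have hdiff := card_mul_le_two_mul_card_product_sdiff C P Q
  rw [hC.card_eq] at hdiff
  rw [hcard, Finset.sum_neg_distrib] at hupper
  rify at hfix hswap hdiff
  have hPQ : (0 : ℝ) ≤ (C \ P).card + (C \ Q).card := by positivity
  push_cast
  linarith [mul_le_mul_of_nonneg_right hdiff hε0, mul_le_mul_of_nonneg_left hε hPQ]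

end MeanGap

section Tail

lemma mul_div_le_sq_div_of_le {k K M ε E : ℝ} (hK : 0 < K) (hk : 0 ≤ k) (hM : 0 ≤ M)
    (hε : 0 ≤ ε) (hupper : M ≤ K * k) (hlower : K * k ≤ 2 * M) (hE : k * (K * ε) / 4 ≤ E) :
    k * (ε ^ 2 * K) / 1024 ≤ E ^ 2 / (2 * (32 * M)) := by
  rcases hM.eq_or_lt with rfl | hM
  · have : k = 0 := by nlinarith
    simp [this]
  · rw [le_div_iff₀ (by positivity)]
    have hsq := pow_le_pow_left₀ (by positivity) hE 2
    have := mul_le_mul_of_nonneg_left hupper (by positivity : 0 ≤ k * (ε ^ 2 * K))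
    linarith

variable {Ω : Type*} [MeasurableSpace Ω] {μ : Measure Ω} [IsProbabilityMeasure μ] {m n K : ℕ}
  {p ρ : ℕ → ℕ → ℝ} {G : Ω → SimpleGraph (Fin m)} {H : Ω → SimpleGraph (Fin n)} {q ε : ℝ}
  {P Q : Finset (Fin m × Fin n)}

namespace IsCorrelatedBernoulli

lemma integral_overlap (h : IsCorrelatedBernoulli μ m n K p ρ G H) (P Q : Finset (Fin m × Fin n)) :
    ∫ ω, overlap (signMatrix (G ω)) (signMatrix (H ω)) P Q ∂μ =
      ∑ τ ∈ P ×ˢ Q, ∫ ω, overlapTerm (signMatrix (G ω)) (signMatrix (H ω)) τ ∂μ :=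
  integral_finsetSum _ fun τ _ => h.integrable_overlapTerm τ

lemma integrable_overlap (h : IsCorrelatedBernoulli μ m n K p ρ G H)
    (P Q : Finset (Fin m × Fin n)) :
    Integrable (fun ω => overlap (signMatrix (G ω)) (signMatrix (H ω)) P Q) μ :=
  integrable_finsetSum _ fun τ _ => h.integrable_overlapTerm τ

lemma le_integral_overlapGap (h : IsCorrelatedBernoulli μ m n K p ρ G H) (hq : 0 < q)
    (hp : ∀ i j, i < j → j < max m n → p i j ∈ Set.Icc q (1 - q))
    (hρ : ∀ i j, i < j → j < K → (1 - 2 * q) ^ 2 + ε ≤ ρ i j) (hε1 : (1 - 2 * q) ^ 2 + ε ≤ 1)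
    (hε : 8 ≤ K * ε) (hP : IsMatching K P) (hQ : IsMatching K Q) :
    ((corePairs m n K \ P).card + (corePairs m n K \ Q).card : ℕ) * (K * ε) / 4 ≤
      ∫ ω, overlapGap (signMatrix (G ω)) (signMatrix (H ω)) (corePairs m n K) P Q ∂μ := by
  simp only [overlapGap]
  rw [integral_sub (h.integrable_overlap _ _) (h.integrable_overlap _ _), h.integral_overlap,
    h.integral_overlap]
  refine le_sum_corePairs_sub_sum h.core_le_left h.core_le_right hP hQ h.integral_overlapTerm_le_one
    (fun s _ => by simp [overlapTerm, signMatrix_self])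
    (fun s hs t ht hst => h.le_integral_overlapTerm hq hp hρ hs ht hst)
    (fun τ hτ hswap => h.integral_signMatrix_mul_le hp fun hedge => ?_) (sq_nonneg _) hε1 hε
  exact hswap (isSwapped_of_edges_eq hτ hedge.1 hedge.2.1 hedge.2.2)

lemma measureReal_overlapGap_nonpos_le (h : IsCorrelatedBernoulli μ m n K p ρ G H) (hq : 0 < q)
    (hp : ∀ i j, i < j → j < max m n → p i j ∈ Set.Icc q (1 - q))
    (hρ : ∀ i j, i < j → j < K → (1 - 2 * q) ^ 2 + ε ≤ ρ i j) (hε1 : (1 - 2 * q) ^ 2 + ε ≤ 1)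
    (hε : 8 ≤ K * ε) (hP : IsMatching K P) (hQ : IsMatching K Q) :
    μ.real {ω | overlapGap (signMatrix (G ω)) (signMatrix (H ω)) (corePairs m n K) P Q ≤ 0} ≤
      Real.exp (-(((corePairs m n K \ P).card + (corePairs m n K \ Q).card : ℕ) *
        (ε ^ 2 * K) / 1024)) := by
  have hC := isMatching_corePairs h.core_le_left h.core_le_right
  have hmean := h.le_integral_overlapGap hq hp hρ hε1 hε hP hQ
  have hmean0 := (by positivity : (0 : ℝ) ≤ _).trans hmean
  refine (measureReal_nonpos_le_exp_of_hasSubgaussianMGF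
    (h.hasSubgaussianMGF_overlapGap hC hP hQ) hmean0).trans (Real.exp_le_exp.2 ?_)
  have hupper := card_product_sdiff_le (corePairs m n K) P Q
  have hlower := card_mul_le_two_mul_card_product_sdiff (corePairs m n K) P Q
  rw [hC.card_eq] at hupper hlower
  rw [neg_div, neg_le_neg_iff, NNReal.coe_mul, NNReal.coe_ofNat, NNReal.coe_natCast]
  exact mul_div_le_sq_div_of_le (Nat.cast_pos.2 h.core_pos) (Nat.cast_nonneg _)
    (Nat.cast_nonneg _) (pos_of_mul_pos_right (by linarith) (Nat.cast_nonneg K)).le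
    (by exact_mod_cast hupper) (by exact_mod_cast hlower) hmean

end IsCorrelatedBernoulli

end Tail

section Argmax

lemma argmaxOn_eq_singleton {α : Type*} {f : α → ℝ} {S : Set α} {z : α} (hz : z ∈ S)
    (h : ∀ x ∈ S, x ≠ z → f x < f z) : argmaxOn f S = {z} := by
  refine Set.eq_singleton_iff_unique_mem.2 ⟨⟨hz, fun y hy => ?_⟩, fun x hx => ?_⟩
  · rcases eq_or_ne y z with rfl | hne
    exacts [le_rfl, (h y hy hne).le]
  · by_contra hne
    exact (h x hx.1 hne).not_ge (hx.2 z hz)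

lemma eq_of_sum_le_one {ι : Type*} [Fintype ι] {f : ι → ℝ} (hf : ∀ i, 0 ≤ f i)
    (hsum : ∑ i, f i ≤ 1) {i j : ι} (hi : f i = 1) (hj : f j = 1) : i = j := by
  classical
  by_contra hne
  have hpair := Finset.sum_le_univ_sum_of_nonneg (s := {i, j}) hf
  rw [Finset.sum_pair hne, hi, hj] at hpair
  linarith

variable {m n K : ℕ} {A : Matrix (Fin m) (Fin m) ℝ} {B : Matrix (Fin n) (Fin n) ℝ}

/-- The matrix whose ones are at the positions in `P`. -/
def indMatrix (P : Finset (Fin m × Fin n)) : Matrix (Fin m) (Fin n) ℝ :=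
  Matrix.of fun i j => if (i, j) ∈ P then 1 else 0

lemma sum_mul_indMatrix (P : Finset (Fin m × Fin n)) (f : Fin m → Fin n → ℝ) :
    ∑ i, ∑ j, f i j * indMatrix P i j = ∑ s ∈ P, f s.1 s.2 := by
  rw [← Fintype.sum_prod_type' fun i j => f i j * indMatrix P i j]
  simp [indMatrix]

lemma coreMatrix_eq_indMatrix : coreMatrix m n K = indMatrix (corePairs m n K) := by
  ext i j
  simp [coreMatrix, indMatrix, mem_corePairs]

lemma IsMatching.indMatrix_mem {P : Finset (Fin m × Fin n)} (hP : IsMatching K P) :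
    indMatrix P ∈ partialPerms m n K := by
  refine ⟨fun i j => ?_, fun i => ?_, fun j => ?_, ?_⟩
  · rw [indMatrix, Matrix.of_apply]
    split_ifs
    exacts [Or.inr rfl, Or.inl rfl]
  · simp only [indMatrix, Matrix.of_apply, Finset.sum_boole]
    refine Nat.cast_le_one.2 (Finset.card_le_one.2 fun a ha b hb => ?_)
    exact congrArg Prod.snd
      (hP.injOn_fst (Finset.mem_filter.1 ha).2 (Finset.mem_filter.1 hb).2 rfl)
  · simp only [indMatrix, Matrix.of_apply, Finset.sum_boole]
    refine Nat.cast_le_one.2 (Finset.card_le_one.2 fun a ha b hb => ?_)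
    exact congrArg Prod.fst
      (hP.injOn_snd (Finset.mem_filter.1 ha).2 (Finset.mem_filter.1 hb).2 rfl)
  · simpa [hP.card_eq] using sum_mul_indMatrix P fun _ _ => 1

lemma exists_isMatching_eq_indMatrix {X : Matrix (Fin m) (Fin n) ℝ}
    (hX : X ∈ partialPerms m n K) : ∃ P, IsMatching K P ∧ X = indMatrix P := by
  classical
  obtain ⟨⟨h0, hrow, hcol, htotal⟩, h01⟩ := mem_partialPerms_iff.1 hX
  let P : Finset (Fin m × Fin n) := Finset.univ.filter fun s => X s.1 s.2 = 1
  have hP {s : Fin m × Fin n} (hs : s ∈ (P : Set (Fin m × Fin n))) : X s.1 s.2 = 1 :=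
    (Finset.mem_filter.1 hs).2
  have hXP : X = indMatrix P := by
    ext i j
    rcases h01 i j with h | h <;> simp [indMatrix, P, h]
  refine ⟨P, ⟨?_, fun s hs t ht hst => ?_, fun s hs t ht hst => ?_⟩, hXP⟩
  · have hcard := sum_mul_indMatrix P fun _ _ => 1
    simp only [← hXP, one_mul, htotal, Finset.sum_const, nsmul_eq_mul, mul_one] at hcard
    exact_mod_cast hcard.symm
  · exact Prod.ext hst (eq_of_sum_le_one (h0 s.1) (hrow s.1) (hP hs) (by rw [hst, hP ht]))
  · exact Prod.ext
      (eq_of_sum_le_one (fun i => h0 i s.2) (hcol s.2) (hP hs) (by rw [hst, hP ht])) hst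

/-- The bilinear form whose quadratic form is `objective A B`. -/
def objectiveBilin (A : Matrix (Fin m) (Fin m) ℝ) (B : Matrix (Fin n) (Fin n) ℝ) :
    Matrix (Fin m) (Fin n) ℝ →ₗ[ℝ] Matrix (Fin m) (Fin n) ℝ →ₗ[ℝ] ℝ :=
  LinearMap.mk₂ ℝ (fun X Y => (A * X * B * Y.transpose).trace)
    (fun X X' Y => by simp [Matrix.mul_add, Matrix.add_mul])
    (fun a X Y => by simp)
    (fun X Y Y' => by simp [Matrix.mul_add])
    (fun a X Y => by simp)

lemma objectiveBilin_indMatrix (hA : ∀ i j, A i j = A j i) (P Q : Finset (Fin m × Fin n)) :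
    objectiveBilin A B (indMatrix P) (indMatrix Q) = overlap A B P Q := by
  have hentry (a : Fin m) (b : Fin n) :
      (A * indMatrix P * B) a b = ∑ s ∈ P, A s.1 a * B s.2 b := by
    rw [← sum_mul_indMatrix P fun i j => A i a * B j b, Finset.sum_comm]
    simp only [Matrix.mul_apply, Finset.sum_mul, mul_right_comm, hA a]
  calc (A * indMatrix P * B * (indMatrix Q).transpose).trace
      = ∑ i, ∑ j, (A * indMatrix P * B) i j * indMatrix Q i j :=
        (Matrix.sum_hadamard_eq _ _).symm
    _ = ∑ t ∈ Q, ∑ s ∈ P, overlapTerm A B (s, t) := by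
        simp only [sum_mul_indMatrix, hentry, overlapTerm]
    _ = overlap A B P Q := by rw [Finset.sum_comm, overlap, Finset.sum_product]

lemma argmaxOn_objective_eq (hA : ∀ i j, A i j = A j i) (hm : K ≤ m) (hn : K ≤ n)
    (hgap : ∀ P Q : Finset (Fin m × Fin n), IsMatching K P → IsMatching K Q →
      (P, Q) ≠ (corePairs m n K, corePairs m n K) → 0 < overlapGap A B (corePairs m n K) P Q) :
    argmaxOn (objective A B) (partialPerms m n K) = {coreMatrix m n K} ∧
      argmaxOn (objective A B) (relaxedPolytope m n K) = {coreMatrix m n K} := by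
  have hcore : coreMatrix m n K ∈ partialPerms m n K := by
    rw [coreMatrix_eq_indMatrix]
    exact (isMatching_corePairs hm hn).indMatrix_mem
  have hbilin : ∀ X ∈ partialPerms m n K, ∀ Y ∈ partialPerms m n K,
      (X, Y) ≠ (coreMatrix m n K, coreMatrix m n K) →
      objectiveBilin A B X Y < objectiveBilin A B (coreMatrix m n K) (coreMatrix m n K) := by
    intro X hX Y hY hne
    obtain ⟨P, hP, rfl⟩ := exists_isMatching_eq_indMatrix hX
    obtain ⟨Q, hQ, rfl⟩ := exists_isMatching_eq_indMatrix hY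
    rw [coreMatrix_eq_indMatrix] at hne ⊢
    rw [objectiveBilin_indMatrix hA, objectiveBilin_indMatrix hA, ← sub_pos]
    exact hgap P Q hP hQ fun e => hne (congrArg (Prod.map indMatrix indMatrix) e)
  have hlt : ∀ X ∈ relaxedPolytope m n K, X ≠ coreMatrix m n K →
      objective A B X < objective A B (coreMatrix m n K) := fun X hX hne =>
    bilin_self_lt_of_mem_convexHull (objectiveBilin A B) hcore hbilin
      (relaxedPolytope_subset_convexHull hm hn hX) hne
  exact ⟨argmaxOn_eq_singleton hcore fun X hX => hlt X (partialPerms_subset_relaxedPolytope hX),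
    argmaxOn_eq_singleton (partialPerms_subset_relaxedPolytope hcore) hlt⟩

end Argmax

section Margin

variable {q : ℝ} {K : ℕ} {ρ : ℕ → ℕ → ℝ}

lemma margin_nonneg (hρ : ∀ i j, i < j → j < K → (1 - 2 * q) ^ 2 ≤ ρ i j) : 0 ≤ margin q K ρ := by
  refine Real.sInf_nonneg ?_
  rintro x ⟨i, j, hij, hj, rfl⟩
  exact sub_nonneg.2 (hρ i j hij hj)

lemma add_margin_le (hρ : ∀ i j, i < j → j < K → (1 - 2 * q) ^ 2 ≤ ρ i j) (i j : ℕ)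
    (hij : i < j) (hj : j < K) : (1 - 2 * q) ^ 2 + margin q K ρ ≤ ρ i j := by
  refine le_sub_iff_add_le'.1 (csInf_le ⟨0, ?_⟩ ⟨i, j, hij, hj, rfl⟩)
  rintro x ⟨i, j, hij, hj, rfl⟩
  exact sub_nonneg.2 (hρ i j hij hj)

lemma two_le_of_margin_ne_zero (hne : margin q K ρ ≠ 0) : 2 ≤ K := by
  contrapose! hne
  have hempty : {x | ∃ i j, i < j ∧ j < K ∧ x = ρ i j - (1 - 2 * q) ^ 2} = ∅ :=
    Set.eq_empty_of_forall_notMem fun _ ⟨i, j, hij, hj, _⟩ => by omega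
  rw [margin, hempty, Real.sInf_empty]

end Margin

section UnionBound

section PowCard

variable {α : Type*} [Fintype α] [DecidableEq α]

lemma sum_pow_card_symmDiff (C : Finset α) (y : ℝ) :
    ∑ P : Finset α, y ^ (symmDiff P C).card = (1 + y) ^ Fintype.card α := by
  have hinv : Function.Involutive fun P : Finset α => symmDiff P C := fun P =>
    symmDiff_symmDiff_cancel_right C P
  rw [← Equiv.sum_comp hinv.toPerm]
  simp only [Function.Involutive.coe_toPerm, symmDiff_symmDiff_cancel_right]
  simpa [add_comm] using Fintype.sum_pow_mul_eq_add_pow α y 1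

lemma sum_erase_pow_card_symmDiff_le (C : Finset α) {y : ℝ} (hy : 0 ≤ y)
    (hy1 : 2 * Fintype.card α * y ≤ 1) :
    ∑ R ∈ (Finset.univ : Finset (Finset α × Finset α)).erase (C, C),
      y ^ ((symmDiff R.1 C).card + (symmDiff R.2 C).card) ≤ 4 * Fintype.card α * y := by
  have htotal : ∑ R : Finset α × Finset α, y ^ ((symmDiff R.1 C).card + (symmDiff R.2 C).card) =
      (1 + y) ^ (2 * Fintype.card α) := by
    simp only [Fintype.sum_prod_type, pow_add, ← Finset.mul_sum, ← Finset.sum_mul,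
      sum_pow_card_symmDiff, two_mul]
  rw [← Finset.add_sum_erase _ _ (Finset.mem_univ (C, C))] at htotal
  simp only [symmDiff_self, Finset.bot_eq_empty, Finset.card_empty, add_zero, pow_zero] at htotal
  have hexp : (1 + y) ^ (2 * Fintype.card α) ≤ Real.exp (2 * Fintype.card α * y) := by
    calc (1 + y) ^ (2 * Fintype.card α) ≤ Real.exp y ^ (2 * Fintype.card α) :=
          pow_le_pow_left₀ (by positivity) (by linarith [Real.add_one_le_exp y]) _
      _ = _ := by rw [← Real.exp_nat_mul]; push_cast; rfl
  have h0 : 0 ≤ 2 * Fintype.card α * y := by positivity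
  have hexp_sub := Real.abs_exp_sub_one_le (x := 2 * Fintype.card α * y) (by rwa [abs_of_nonneg h0])
  rw [abs_of_nonneg h0] at hexp_sub
  linarith [le_of_abs_le hexp_sub]

end PowCard

variable {Ω : Type*} [MeasurableSpace Ω] {μ : Measure Ω} {m n K : ℕ} {p ρ : ℕ → ℕ → ℝ}
  {G : Ω → SimpleGraph (Fin m)} {H : Ω → SimpleGraph (Fin n)} {q ε : ℝ} {N : ℕ}
  {P Q : Finset (Fin m × Fin n)}

/-- The event that some pair of matchings other than the core overlaps at least as much as the core
does with itself. -/
def mismatchEvent (K : ℕ) (G : Ω → SimpleGraph (Fin m)) (H : Ω → SimpleGraph (Fin n)) : Set Ω :=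
  {ω | ∃ P Q : Finset (Fin m × Fin n), IsMatching K P ∧ IsMatching K Q ∧
    (P, Q) ≠ (corePairs m n K, corePairs m n K) ∧
    overlapGap (signMatrix (G ω)) (signMatrix (H ω)) (corePairs m n K) P Q ≤ 0}

lemma measureReal_mismatchEvent_le_sum [IsFiniteMeasure μ]
    {f : Finset (Fin m × Fin n) × Finset (Fin m × Fin n) → ℝ} (hf : ∀ R, 0 ≤ f R)
    (h : ∀ P Q, IsMatching K P → IsMatching K Q →
      μ.real {ω | overlapGap (signMatrix (G ω)) (signMatrix (H ω)) (corePairs m n K) P Q ≤ 0} ≤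
        f (P, Q)) :
    μ.real (mismatchEvent K G H) ≤
      ∑ R ∈ Finset.univ.erase (corePairs m n K, corePairs m n K), f R := by
  calc μ.real (mismatchEvent K G H)
      ≤ μ.real (⋃ R ∈ Finset.univ.erase (corePairs m n K, corePairs m n K),
          {ω | IsMatching K R.1 ∧ IsMatching K R.2 ∧
            overlapGap (signMatrix (G ω)) (signMatrix (H ω)) (corePairs m n K) R.1 R.2 ≤ 0}) := by
        refine measureReal_mono ?_ (measure_ne_top _ _)
        rintro ω ⟨P, Q, hP, hQ, hne, hgap⟩
        exact Set.mem_biUnion (x := (P, Q)) (Finset.mem_erase.2 ⟨hne, Finset.mem_univ _⟩)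
          ⟨hP, hQ, hgap⟩
    _ ≤ _ := (measureReal_biUnion_finset_le _ _).trans (Finset.sum_le_sum fun R _ => ?_)
  by_cases hR : IsMatching K R.1 ∧ IsMatching K R.2
  · simpa only [hR.1, hR.2, true_and] using h R.1 R.2 hR.1 hR.2
  · simpa only [← and_assoc, hR, false_and, Set.ofPred_false, measureReal_empty] using hf R

lemma ae_eventually_notMem_of_measureReal_le [IsFiniteMeasure μ] {s : ℕ → Set Ω} {f : ℕ → ℝ}
    (hf : Summable f) (h : ∀ᶠ N in Filter.atTop, μ.real (s N) ≤ f N) :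
    ∀ᵐ ω ∂μ, ∀ᶠ N in Filter.atTop, ω ∉ s N := by
  obtain ⟨N₀, hN₀⟩ := Filter.eventually_atTop.1 h
  have hsum : ∑' N, μ (s (N + N₀)) ≠ ⊤ := by
    refine ne_top_of_le_ne_top ((summable_nat_add_iff N₀).2 hf).tsum_ofReal_ne_top
      (ENNReal.tsum_le_tsum fun N => ?_)
    rw [← ofReal_measureReal]
    exact ENNReal.ofReal_le_ofReal (hN₀ _ (Nat.le_add_left _ _))
  filter_upwards [ae_eventually_notMem hsum] with ω hω
  rwa [← Filter.map_add_atTop_eq_nat N₀, Filter.eventually_map]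

namespace IsCorrelatedBernoulli

variable [IsProbabilityMeasure μ]

lemma measureReal_overlapGap_nonpos_le_pow (h : IsCorrelatedBernoulli μ m n K p ρ G H)
    (hq : 0 < q) (hp : ∀ i j, i < j → j < max m n → p i j ∈ Set.Icc q (1 - q))
    (hρ : ∀ i j, i < j → j < K → (1 - 2 * q) ^ 2 + ε ≤ ρ i j) (hε1 : (1 - 2 * q) ^ 2 + ε ≤ 1)
    (hε : 8 ≤ K * ε) (hP : IsMatching K P) (hQ : IsMatching K Q) (hN : 0 < N)
    (hlog : 8192 * Real.log N ≤ ε ^ 2 * K) :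
    μ.real {ω | overlapGap (signMatrix (G ω)) (signMatrix (H ω)) (corePairs m n K) P Q ≤ 0} ≤
      ((N : ℝ) ^ 4)⁻¹ ^ ((symmDiff P (corePairs m n K)).card +
        (symmDiff Q (corePairs m n K)).card) := by
  have hC := isMatching_corePairs h.core_le_left h.core_le_right
  refine (h.measureReal_overlapGap_nonpos_le hq hp hρ hε1 hε hP hQ).trans ?_
  have hNexp : ((N : ℝ) ^ 4)⁻¹ = Real.exp (-(4 * Real.log N)) := by
    rw [← Real.exp_log (show 0 < ((N : ℝ) ^ 4)⁻¹ by positivity), Real.log_inv, Real.log_pow,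
      Nat.cast_ofNat]
  rw [symmDiff_comm P, symmDiff_comm Q, card_symmDiff_of_card_eq (hP.card_eq.trans hC.card_eq.symm),
    card_symmDiff_of_card_eq (hQ.card_eq.trans hC.card_eq.symm), ← mul_add, hNexp,
    ← Real.exp_nat_mul, Real.exp_le_exp]
  have hmul := mul_le_mul_of_nonneg_left hlog
    (Nat.cast_nonneg (α := ℝ) ((corePairs m n K \ P).card + (corePairs m n K \ Q).card))
  push_cast at hmul ⊢
  linarith

lemma measureReal_mismatchEvent_le (h : IsCorrelatedBernoulli μ m n K p ρ G H) (hq : 0 < q)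
    (hp : ∀ i j, i < j → j < max m n → p i j ∈ Set.Icc q (1 - q))
    (hρ : ∀ i j, i < j → j < K → (1 - 2 * q) ^ 2 + ε ≤ ρ i j) (hε1 : (1 - 2 * q) ^ 2 + ε ≤ 1)
    (hε : 8 ≤ K * ε) (hm : m ≤ N) (hn : n ≤ N) (hN : 2 ≤ N)
    (hlog : 8192 * Real.log N ≤ ε ^ 2 * K) :
    μ.real (mismatchEvent K G H) ≤ 4 * ((N : ℝ) ^ 2)⁻¹ := by
  have hN' : (2 : ℝ) ≤ N := by exact_mod_cast hN
  have hcard : (Fintype.card (Fin m × Fin n) : ℝ) ≤ (N : ℝ) ^ 2 := by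
    rw [Fintype.card_prod, Fintype.card_fin, Fintype.card_fin, sq]
    exact_mod_cast Nat.mul_le_mul hm hn
  have hcard_mul : Fintype.card (Fin m × Fin n) * ((N : ℝ) ^ 4)⁻¹ ≤ ((N : ℝ) ^ 2)⁻¹ := by
    calc _ ≤ (N : ℝ) ^ 2 * ((N : ℝ) ^ 4)⁻¹ := by gcongr
      _ = _ := by field_simp
  have hinv : ((N : ℝ) ^ 2)⁻¹ ≤ (2 ^ 2)⁻¹ := by gcongr
  calc μ.real (mismatchEvent K G H)
      ≤ ∑ R ∈ Finset.univ.erase (corePairs m n K, corePairs m n K), ((N : ℝ) ^ 4)⁻¹ ^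
          ((symmDiff R.1 (corePairs m n K)).card + (symmDiff R.2 (corePairs m n K)).card) :=
        measureReal_mismatchEvent_le_sum (fun R => by positivity) fun P Q hP hQ =>
          h.measureReal_overlapGap_nonpos_le_pow hq hp hρ hε1 hε hP hQ (by omega) hlog
    _ ≤ 4 * Fintype.card (Fin m × Fin n) * ((N : ℝ) ^ 4)⁻¹ :=
        sum_erase_pow_card_symmDiff_le _ (by positivity) (by linarith)
    _ ≤ 4 * ((N : ℝ) ^ 2)⁻¹ := by linarith

lemma measureReal_mismatchEvent_le_of_margin (h : IsCorrelatedBernoulli μ m n K p ρ G H)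
    (hq : 0 < q) (hp : ∀ i j, i < j → j < max m n → p i j ∈ Set.Icc q (1 - q))
    (hρ : ∀ i j, i < j → j < K → (1 - 2 * q) ^ 2 ≤ ρ i j) (hm : m ≤ N) (hn : n ≤ N) (hN : 2 ≤ N)
    (hlog : 8192 * Real.log N ≤ margin q K ρ ^ 2 * K) :
    μ.real (mismatchEvent K G H) ≤ 4 * ((N : ℝ) ^ 2)⁻¹ := by
  have hlog2 : Real.log 2 ≤ Real.log N := Real.log_le_log two_pos (by exact_mod_cast hN)
  have hlarge : 8 ≤ margin q K ρ ^ 2 * K := by linarith [Real.log_two_gt_d9]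
  have hK : 2 ≤ K := two_le_of_margin_ne_zero (ρ := ρ) (q := q) fun h0 => by
    norm_num [h0] at hlarge
  have hadd_le : (1 - 2 * q) ^ 2 + margin q K ρ ≤ 1 :=
    (add_margin_le hρ 0 1 one_pos hK).trans (h.ρ_mem 0 1 one_pos hK).2
  have hsq : margin q K ρ ^ 2 ≤ margin q K ρ :=
    pow_le_of_le_one (margin_nonneg hρ) (by linarith [sq_nonneg (1 - 2 * q)]) two_ne_zero
  refine h.measureReal_mismatchEvent_le hq hp (add_margin_le hρ) hadd_le ?_ hm hn hN hlog
  rw [mul_comm]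
  exact hlarge.trans (by gcongr)

end IsCorrelatedBernoulli

end UnionBound

end SubgraphMatching

open SubgraphMatching in
theorem theorem1_general {Ω : Type*} [MeasurableSpace Ω] (μ : MeasureTheory.Measure Ω)
    [MeasureTheory.IsProbabilityMeasure μ]
    (m n K : ℕ → ℕ) (p ρ : ℕ → ℕ → ℕ → ℝ)
    (G : (N : ℕ) → Ω → SimpleGraph (Fin (m N))) (H : (N : ℕ) → Ω → SimpleGraph (Fin (n N)))
    (hmax : ∀ N, 1 ≤ N → max (m N) (n N) = N)
    (hmodel : ∀ N, 1 ≤ N →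
      IsCorrelatedBernoulli μ (m N) (n N) (K N) (p N) (ρ N) (G N) (H N))
    (q : ℝ) (hq0 : 0 < q)
    (hp : ∀ N, 1 ≤ N → ∀ i j, i < j → j < N → p N i j ∈ Set.Icc q (1 - q))
    (hρ : ∀ N, 1 ≤ N → ∀ i j, i < j → j < K N → (1 - 2 * q) ^ 2 ≤ ρ N i j)
    (hε : ∀ᶠ N : ℕ in Filter.atTop,
      8192 * Real.log (N : ℝ) ≤ margin q (K N) (ρ N) ^ 2 * (K N : ℝ)) :
    ∀ᵐ ω ∂μ, ∀ᶠ N in Filter.atTop,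
      argmaxOn
          (objective (signMatrix (G N ω))
            (signMatrix (H N ω)))
          (partialPerms (m N) (n N) (K N)) =
        {coreMatrix (m N) (n N) (K N)} ∧
      argmaxOn
          (objective (signMatrix (G N ω))
            (signMatrix (H N ω)))
          (relaxedPolytope (m N) (n N) (K N)) =
        {coreMatrix (m N) (n N) (K N)} := by
  have hmismatch : ∀ᶠ N : ℕ in Filter.atTop,
      μ.real (mismatchEvent (K N) (G N) (H N)) ≤ 4 * ((N : ℝ) ^ 2)⁻¹ := by
    filter_upwards [hε, Filter.eventually_ge_atTop 2] with N hlog hN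
    have hN1 : 1 ≤ N := one_le_two.trans hN
    refine (hmodel N hN1).measureReal_mismatchEvent_le_of_margin hq0 ?_ (hρ N hN1)
      ((le_max_left _ _).trans_eq (hmax N hN1)) ((le_max_right _ _).trans_eq (hmax N hN1)) hN hlog
    rw [hmax N hN1]
    exact hp N hN1
  have hsummable : Summable fun N : ℕ => 4 * ((N : ℝ) ^ 2)⁻¹ :=
    (Real.summable_nat_pow_inv.2 one_lt_two).mul_left 4
  filter_upwards [ae_eventually_notMem_of_measureReal_le hsummable hmismatch] with ω hω
  filter_upwards [hω, Filter.eventually_ge_atTop 1] with N hN hN1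
  exact argmaxOn_objective_eq (signMatrix_comm _)
    (hmodel N hN1).core_le_left (hmodel N hN1).core_le_right fun P Q hP hQ hne =>
      not_le.1 fun hgap => hN ⟨P, Q, hP, hQ, hne, hgap⟩

theorem theorem1 {Ω : Type*} [MeasurableSpace Ω] (μ : MeasureTheory.Measure Ω)
    [MeasureTheory.IsProbabilityMeasure μ]
    (m n K : ℕ → ℕ) (p ρ : ℕ → ℕ → ℕ → ℝ)
    (G : (N : ℕ) → Ω → SimpleGraph (Fin (m N))) (H : (N : ℕ) → Ω → SimpleGraph (Fin (n N)))
    (hmax : ∀ N, 1 ≤ N → max (m N) (n N) = N)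
    (hmodel : ∀ N, 1 ≤ N →
      SubgraphMatching.IsCorrelatedBernoulli μ (m N) (n N) (K N) (p N) (ρ N) (G N) (H N))
    (q : ℝ) (hq0 : 0 < q) (hq : q < 1 / 2)
    (hp : ∀ N, 1 ≤ N → ∀ i j, i < j → j < N → p N i j ∈ Set.Icc q (1 - q))
    (hρ : ∀ N, 1 ≤ N → ∀ i j, i < j → j < K N → (1 - 2 * q) ^ 2 < ρ N i j)
    (hε : Filter.Tendsto
      (fun N : ℕ => SubgraphMatching.margin q (K N) (ρ N) ^ 2 * (K N : ℝ) / Real.log (N : ℝ))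
      Filter.atTop Filter.atTop) :
    ∀ᵐ ω ∂μ, ∀ᶠ N in Filter.atTop,
      SubgraphMatching.argmaxOn
          (SubgraphMatching.objective (SubgraphMatching.signMatrix (G N ω))
            (SubgraphMatching.signMatrix (H N ω)))
          (SubgraphMatching.partialPerms (m N) (n N) (K N)) =
        {SubgraphMatching.coreMatrix (m N) (n N) (K N)} ∧
      SubgraphMatching.argmaxOn
          (SubgraphMatching.objective (SubgraphMatching.signMatrix (G N ω))
            (SubgraphMatching.signMatrix (H N ω)))
          (SubgraphMatching.relaxedPolytope (m N) (n N) (K N)) =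
        {SubgraphMatching.coreMatrix (m N) (n N) (K N)} := by
  refine theorem1_general μ m n K p ρ G H hmax hmodel q hq0 hp
    (fun N hN i j hij hj => (hρ N hN i j hij hj).le) ?_
  filter_upwards [hε.eventually_ge_atTop 8192, Filter.eventually_gt_atTop 1] with N hN hN1
  exact (le_div_iff₀ (Real.log_pos (Nat.one_lt_cast.2 hN1))).1 hN
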